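/- **Theorem (Central Limit Theorem for $\alpha$-SMC with randomised $C$-connectivity).** Let $(\mathsf X,\mathcal X)$ be a measurable space, $\pi_0$ a probability measure on it, $(K_t)_{t\ge1}$ Markov kernels on it, and $(g_t)_{t\ge0}$ measurable functions such that, for some constant $\kappa_g$, $0<g_t(x)\le\kappa_g$ for all $t\ge0$, $x\in\mathsf X$. For bounded measurable $\phi:\mathsf X\to\mathbb R$ set $$\gamma_t(\phi)=\int \pi_0(dx_0)\prod_{s=1}^tK_s(x_{s-1},dx_s)\prod_{s=0}^{t-1}g_s(x_s)\,\phi(x_t),\qquad Z_t=\gamma_t(1),\qquad \pi_t(\phi)=\gamma_t(\phi)/Z_t,$$ $\mathsf Q_t\phi=g_{t-1}\,K_t\phi$, $\widetilde{\mathsf Q}_t\phi=g_{t-1}^2\,K_t\phi$ $(t\ge1)$. Fix an integer $C\ge1$ and let $\mu_0=\pi_0$ and $\mu_t(\phi)=\frac1C\,\mu_{t-1}(\widetilde{\mathsf Q}_t\phi)+\frac{C-1}{C}\,Z_t^2\,\pi_t(\phi)$ for $t\ge1$. For $N\ge C$ consider the following system of $N$ particles. The particles $X_0^1,\dots,X_0^N$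 are i.i.d. with law $\pi_0$ and $W_0^i=1$. For each $t\ge0$, $\alpha_t=(\alpha_t^{ij})$ is a random $N\times N$ matrix, independent of everything simulated before it (the particles up to time $t$ and the matrices up to time $t-1$), whose rows are independent; each row has exactly $C$ entries equal to $1/C$ and the others equal to $0$, the $C$ positions being sampled uniformly without replacement from $\{1,\dots,N\}$. Then $W_{t+1}^i=\sum_j\alpha_t^{ij}W_t^jg_t(X_t^j)$ and, conditionally on the particles and the matrices up to time $t$, the particles $X_{t+1}^i$, $1\le i\le N$, are independent, $X_{t+1}^i$ having the law $\frac1{W_{t+1}^i}\sum_j\alpha_t^{ij}W_t^jg_t(X_t^j)\,K_{t+1}(X_t^j,\cdot)$. Let $$\widehat\gamma_t^N(\phi)=\frac1N\sum_{i=1}^NW_t^i\,\phi(X_t^i),\qquad \widehat\pi_t^N(\phi)=\frac{\sum_{i=1}^N W_t^i\,\phi(X_t^i)}{\sum_{k=1}^N W_t^k}.$$ Then there are non-negative functionals $\mathbb V^\gamma_t$, $\mathbb V^\pi_t$, depending only on $\pi_0$, $(K_t)$, $(g_t)$ and $C$, such that for every $t\ge0$ and every bounded measurable $\phi$, as $N\to\infty$,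 $\sqrt N\,(\widehat\gamma^N_t(\phi)-\gamma_t(\phi))$ and $\sqrt N\,(\widehat\pi^N_t(\phi)-\pi_t(\phi))$ converge in law to the (possibly degenerate) Gaussian distributions $\mathcal N(0,\mathbb V^\gamma_t(\phi))$ and $\mathcal N(0,\mathbb V^\pi_t(\phi))$ respectively. They satisfy $\mathbb V^\gamma_0(\phi)=\mathbb V^\pi_0(\phi)=\mathrm{Var}_{\pi_0}(\phi)$ and, for $t\ge1$, $$\mathbb V^\gamma_t(\phi)=\mathbb V^\gamma_{t-1}(\mathsf Q_t\phi)+\mu_t(\phi^2)-Z_t^2\,\pi_t(\phi)^2,$$ $$\mathbb V^\pi_t(\phi)=\frac{\mathbb V^\pi_{t-1}\big(\mathsf Q_t(\phi-\pi_t(\phi))\big)}{\pi_{t-1}(g_{t-1})^2}+\frac{\mu_t\big((\phi-\pi_t(\phi))^2\big)}{Z_t^2}.$$ -/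

import Mathlib

open MeasureTheory ProbabilityTheory Filter
open scoped NNReal

noncomputable section

namespace AlphaSMC

variable {S : Type*} [MeasurableSpace S]

/-! ### The state-space model

`π₀` is the initial law, `K t` (for `t ≥ 1`) is the Markov kernel that leads from time `t - 1` to
time `t` (the value `K 0` is never used), and `g t` (for `t ≥ 0`) is the potential at time `t`. -/

/-- Bounded measurable real functions. -/
def IsTestFunction (φ : S → ℝ) : Prop :=
  Measurable φ ∧ ∃ M : ℝ, ∀ x, |φ x| ≤ M

/-- The iterated integral over the coordinates at the times `t + 1, …, t + n`, started from `x` at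
time `t`, namely
`∫ g t (x_t) K_{t+1}(x_t, dx_{t+1}) g (t+1) (x_{t+1}) ⋯ K_{t+n}(x_{t+n-1}, dx_{t+n}) φ(x_{t+n})`
with `x_t = x`; the potentials run over the times `t, …, t + n - 1`. -/
def pathIntegral (K : ℕ → Kernel S S) (g : ℕ → S → ℝ) (φ : S → ℝ) : ℕ → ℕ → S → ℝ
  | 0, _, x => φ x
  | n + 1, t, x => g t x * ∫ y, pathIntegral K g φ n (t + 1) y ∂(K (t + 1) x)

/-- The unnormalised target `γ_t(φ)`, the integral of `∏_{s < t} g s (x_s) φ(x_t)` against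
`π₀(dx_0) K_1(x_0, dx_1) ⋯ K_t(x_{t-1}, dx_t)`. -/
def gammaTarget (π₀ : Measure S) (K : ℕ → Kernel S S) (g : ℕ → S → ℝ) (t : ℕ) (φ : S → ℝ) : ℝ :=
  ∫ x, pathIntegral K g φ t 0 x ∂π₀

/-- The normalisation constant `Z_t`. -/
def normConst (π₀ : Measure S) (K : ℕ → Kernel S S) (g : ℕ → S → ℝ) (t : ℕ) : ℝ :=
  gammaTarget π₀ K g t (fun _ => 1)

/-- The normalised target `π_t(φ)`. -/
def piTarget (π₀ : Measure S) (K : ℕ → Kernel S S) (g : ℕ → S → ℝ) (t : ℕ) (φ : S → ℝ) : ℝ :=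
  (1 / normConst π₀ K g t) * gammaTarget π₀ K g t φ

/-- The operator `Q_t φ = g_{t-1} K_t φ`, for `t ≥ 1`; here `Qop K g t` is `Q_{t+1}`. -/
def Qop (K : ℕ → Kernel S S) (g : ℕ → S → ℝ) (t : ℕ) (φ : S → ℝ) : S → ℝ :=
  fun x => g t x * ∫ y, φ y ∂(K (t + 1) x)

/-- The operator `φ ↦ g_{t-1}² K_t φ`, for `t ≥ 1`; here `QopSq K g t` is the one with index
`t + 1`. -/
def QopSq (K : ℕ → Kernel S S) (g : ℕ → S → ℝ) (t : ℕ) (φ : S → ℝ) : S → ℝ :=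
  fun x => (g t x) ^ 2 * ∫ y, φ y ∂(K (t + 1) x)

/-- The limiting second-moment measure `μ_t(φ)` for connectivity `C`. -/
def muTarget (π₀ : Measure S) (K : ℕ → Kernel S S) (g : ℕ → S → ℝ) (C : ℕ) :
    ℕ → (S → ℝ) → ℝ
  | 0, φ => ∫ x, φ x ∂π₀
  | t + 1, φ =>
      (1 / (C : ℝ)) * muTarget π₀ K g C t (QopSq K g t φ)
        + (((C : ℝ) - 1) / C) * normConst π₀ K g (t + 1) ^ 2 * piTarget π₀ K g (t + 1) φ

/-! ### The randomised connectivity matrices -/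

/-- The vectors of length `N` with exactly `C` entries equal to `1 / C`, all others being `0`. -/
def connRows (N C : ℕ) : Set (Fin N → ℝ) :=
  {r | ∃ s : Finset (Fin N), s.card = C ∧ r = fun j => if j ∈ s then 1 / (C : ℝ) else 0}

/-- The law of a random `N × N` connectivity matrix: the rows are independent, and in each row the
`C` positions of the entries `1 / C` are sampled uniformly without replacement. -/
def connLaw (N C : ℕ) : Measure (Fin N → Fin N → ℝ) :=
  Measure.pi fun _ : Fin N => uniformOn (connRows N C)

/-! ### The particle system

A trajectory consists of particles `x t i` and connectivity matrices `a t i j`. -/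

/-- The unnormalised weights: `W_0^i = 1` and
`W_{t+1}^i = ∑_j a_t^{ij} W_t^j g_t(x_t^j)`. -/
def weight {N : ℕ} (g : ℕ → S → ℝ) (x : ℕ → Fin N → S) (a : ℕ → Fin N → Fin N → ℝ) :
    ℕ → Fin N → ℝ
  | 0, _ => 1
  | t + 1, i => ∑ j, a t i j * weight g x a t j * g t (x t j)

/-- The particle approximation of `γ_t(φ)`. -/
def gammaHat {N : ℕ} (g : ℕ → S → ℝ) (x : ℕ → Fin N → S) (a : ℕ → Fin N → Fin N → ℝ)
    (t : ℕ) (φ : S → ℝ) : ℝ :=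
  (1 / (N : ℝ)) * ∑ i, weight g x a t i * φ (x t i)

/-- The particle approximation of `π_t(φ)`. -/
def piHat {N : ℕ} (g : ℕ → S → ℝ) (x : ℕ → Fin N → S) (a : ℕ → Fin N → Fin N → ℝ)
    (t : ℕ) (φ : S → ℝ) : ℝ :=
  ∑ i, (weight g x a t i / ∑ k, weight g x a t k) * φ (x t i)

/-- `W_{t+1}^i⁻¹ ∑_j a_t^{ij} W_t^j g_t(x_t^j) K_{t+1}(x_t^j, B)`, the conditional probability that
particle `i` at time `t + 1` lies in `B`. -/
def moveProb {N : ℕ} (K : ℕ → Kernel S S) (g : ℕ → S → ℝ) (x : ℕ → Fin N → S)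
    (a : ℕ → Fin N → Fin N → ℝ) (t : ℕ) (i : Fin N) (B : Set S) : ℝ :=
  (1 / weight g x a (t + 1) i)
    * ∑ j, a t i j * weight g x a t j * g t (x t j) * (K (t + 1) (x t j)).real B

section Run

variable {Ω : Type*} {N : ℕ}

/-- The σ-algebra generated by the particles at the times `s ≤ t` and the matrices at the times
`s < t`: everything that is simulated before the matrix of time `t`. -/
abbrev sigmaBefore (X : ℕ → Ω → Fin N → S) (α : ℕ → Ω → Fin N → Fin N → ℝ) (t : ℕ) :
    MeasurableSpace Ω :=
  (⨆ s : ℕ, ⨆ _ : s ≤ t, MeasurableSpace.comap (X s) inferInstance) ⊔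
    (⨆ s : ℕ, ⨆ _ : s < t, MeasurableSpace.comap (α s) inferInstance)

/-- The σ-algebra generated by the particles and the matrices at the times `s ≤ t`. -/
abbrev sigmaUpTo (X : ℕ → Ω → Fin N → S) (α : ℕ → Ω → Fin N → Fin N → ℝ) (t : ℕ) :
    MeasurableSpace Ω :=
  (⨆ s : ℕ, ⨆ _ : s ≤ t, MeasurableSpace.comap (X s) inferInstance) ⊔
    (⨆ s : ℕ, ⨆ _ : s ≤ t, MeasurableSpace.comap (α s) inferInstance)

/-- `(X, α)` is a run, on the probability space `(Ω, P)`, of the `α`-SMC algorithm with `N`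
particles and randomised `C`-connectivity: `X t ω i` is the particle `i` at time `t`, and
`α t ω i j` is the entry `(i, j)` of the connectivity matrix of time `t`. -/
structure IsRun [MeasurableSpace Ω] (P : Measure Ω) (π₀ : Measure S) (K : ℕ → Kernel S S)
    (g : ℕ → S → ℝ) (C : ℕ) (X : ℕ → Ω → Fin N → S) (α : ℕ → Ω → Fin N → Fin N → ℝ) :
    Prop where
  measurable_particles : ∀ t, Measurable (X t)
  measurable_matrix : ∀ t, Measurable (α t)
  /-- The initial particles are i.i.d. with law `π₀`. -/
  law_init : P.map (X 0) = Measure.pi fun _ : Fin N => π₀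
  /-- Every connectivity matrix is drawn from the `C`-connectivity law ... -/
  law_matrix : ∀ t, P.map (α t) = connLaw N C
  /-- ... independently of all that was simulated before. -/
  indep_matrix : ∀ t, Indep (MeasurableSpace.comap (α t) inferInstance) (sigmaBefore X α t) P
  /-- Given the past, the particles of time `t + 1` are independent, particle `i` having the law
  `W_{t+1}^i⁻¹ ∑_j α_t^{ij} W_t^j g_t(X_t^j) K_{t+1}(X_t^j, ·)`. -/
  law_move : ∀ (t : ℕ) (B : Fin N → Set S), (∀ i, MeasurableSet (B i)) →
    P⟦{ω | ∀ i, X (t + 1) ω i ∈ B i} | sigmaUpTo X α t⟧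
      =ᵐ[P] fun ω => ∏ i, moveProb K g (fun s => X s ω) (fun s => α s ω) t i (B i)

end Run

end AlphaSMC

end

noncomputable section

namespace AlphaSMC

/-! ### Characteristic functions of normalised sums -/

/-! Call the family of pairs (W_t^j g_t(X_t^j), X_t^j) the weighted sample of time t. The rows of
α_t are independent, identically distributed and independent of the past, and particle i is moved
using row i alone. Hence, given the weighted sample, the pairs (row i, new particle i) are i.i.d.
(`condIID_succ`), and γ̂_{t+1}(φ) is the mean of N conditionally i.i.d. bounded variables W_{t+1}^i
φ(X_{t+1}^i).

The weight W_{t+1}^i cancels the denominator in the law of X_{t+1}^i, so the conditional moments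
reduce to moments of a row: E r_j = 1/N, E r_j² = 1/(CN), and E r_j r_k = (C-1)/(CN(N-1)) for j ≠ k.
The conditional mean is exactly γ̂_t(Q φ). The conditional second moment is, up to O(1/N), the
recursion defining μ_{t+1}(φ²), with γ_t and μ_t replaced by `gammaHat` and `secondHat`. Induction
on t therefore gives mean square errors O(1/N) for both estimators (`rootNConsistent_gammaHat`,
`rootNConsistent_secondHat`).

For the fluctuations, √N(γ̂_{t+1}(φ) - γ_{t+1}(φ)) is the sum of √N(γ̂_t(Q φ) - γ_t(Q φ)), a
function of the weighted sample, and of a normalised sum that is conditionally centred and i.i.d.,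
with conditional variance close to the constant v = μ_{t+1}(φ²) - γ_{t+1}(φ)². A quantitative bound
on characteristic functions (`CondIID.norm_integral_cexp_sub_le`) shows that the second term
contributes the factor exp(-u²v/2) up to O(N^{-1/2}). The variances thus add, and the induction
yields a Gaussian limit. `CondIID` is phrased with products of complex test functions so that these
exponentials can be inserted directly.

The self-normalised estimator is a ratio. After φ is replaced by φ - π_t(φ), its denominator may be
replaced by Z_t at a cost of order 1/N, so V^π_t(φ) = V^γ_t(φ - π_t(φ)) / Z_t². Lévy's continuity
theorem turns both limits into convergence in law. -/

lemma norm_cexp_mul_I_sub_quadratic_le (x : ℝ) :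
    ‖Complex.exp (x * Complex.I) - (1 + x * Complex.I - x ^ 2 / 2)‖ ≤ 4 * |x| ^ 3 := by
  rcases le_or_gt |x| 1 with h | h
  · have hx : ‖(x : ℂ) * Complex.I‖ ≤ 1 := by simpa using h
    have := Complex.exp_bound hx (n := 3) (by norm_num)
    have e : ∑ m ∈ Finset.range 3, ((x : ℂ) * Complex.I) ^ m / (m.factorial : ℂ)
        = 1 + x * Complex.I - x ^ 2 / 2 := by
      simp only [Finset.sum_range_succ, Finset.range_zero, Finset.sum_empty, mul_pow, Complex.I_sq]
      simp [Nat.factorial]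
      ring
    rw [e] at this
    refine this.trans ?_
    simp only [norm_mul, Complex.norm_real, Complex.norm_I, mul_one, Real.norm_eq_abs]
    have h3 : (0 : ℝ) ≤ |x| ^ 3 := by positivity
    norm_num [Nat.factorial]
    linarith
  -- For |x| > 1 no cancellation is needed: the triangle inequality gives 2 + |x| + |x|²/2 ≤
  -- (7/2)|x|³, whence the constant 4.
  · have h1 : ‖Complex.exp (x * Complex.I)‖ = 1 := Complex.norm_exp_ofReal_mul_I x
    have h2 : ‖(1 + x * Complex.I - x ^ 2 / 2 : ℂ)‖ ≤ 1 + |x| + |x| ^ 2 / 2 := by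
      refine (norm_sub_le _ _).trans ?_
      gcongr
      · refine (norm_add_le _ _).trans ?_
        simp
      · simp
    refine (norm_sub_le _ _).trans ?_
    rw [h1]
    have h3 : |x| ≤ |x| ^ 3 := by nlinarith [sq_nonneg (|x| - 1), sq_nonneg |x|]
    have h4 : |x| ^ 2 ≤ |x| ^ 3 := by nlinarith [sq_nonneg |x|]
    linarith

/-- Factors are exchanged one at a time; in the closed unit disc each exchange costs at most ‖a -
b‖. This turns an estimate for one summand into one for the characteristic function of the sum. -/
lemma norm_pow_sub_pow_le_mul {a b : ℂ} (ha : ‖a‖ ≤ 1) (hb : ‖b‖ ≤ 1) (n : ℕ) :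
    ‖a ^ n - b ^ n‖ ≤ n * ‖a - b‖ := by
  induction n with
  | zero => simp
  | succ n ih =>
    have : a ^ (n + 1) - b ^ (n + 1) = a ^ n * (a - b) + (a ^ n - b ^ n) * b := by ring
    rw [this]
    refine (norm_add_le _ _).trans ?_
    rw [norm_mul, norm_mul, norm_pow]
    have h1 : ‖a‖ ^ n ≤ 1 := pow_le_one₀ (norm_nonneg _) ha
    have h2 : ‖a ^ n - b ^ n‖ * ‖b‖ ≤ (n * ‖a - b‖) * 1 := by gcongr
    push_cast
    nlinarith [norm_nonneg (a - b)]

lemma abs_exp_neg_sub_one_add_le {y : ℝ} (hy : 0 ≤ y) :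
    |Real.exp (-y) - (1 - y)| ≤ y ^ 2 := by
  rcases le_or_gt y 1 with h | h
  · have := Real.abs_exp_sub_one_sub_id_le (x := -y) (by rwa [abs_neg, abs_of_nonneg hy])
    rwa [neg_sq, show Real.exp (-y) - 1 - -y = Real.exp (-y) - (1 - y) by ring] at this
  · have h1 := Real.add_one_le_exp (-y)
    have h2 : Real.exp (-y) ≤ 1 := Real.exp_le_one_iff.2 (by linarith)
    rw [abs_of_nonneg (by linarith)]
    nlinarith

lemma norm_integral_cexp_mul_I_le_one {T : Type*} [MeasurableSpace T] (ν : Measure T)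
    [IsProbabilityMeasure ν] (f : T → ℝ) : ‖∫ z, Complex.exp (f z * Complex.I) ∂ν‖ ≤ 1 := by
  have := norm_integral_le_of_norm_le_const (μ := ν) (C := 1)
    (f := fun z => Complex.exp (f z * Complex.I))
    (ae_of_all _ fun z => (Complex.norm_exp_ofReal_mul_I _).le)
  simpa using this

lemma integrable_of_measurable_abs_le {T : Type*} [MeasurableSpace T] {ν : Measure T}
    [IsFiniteMeasure ν] {f : T → ℝ} (hf : Measurable f) {b : ℝ} (hb : ∀ z, |f z| ≤ b) :
    Integrable f ν :=
  Integrable.of_bound hf.aestronglyMeasurable b (ae_of_all _ hb)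

lemma abs_integral_le_of_abs_le {T : Type*} [MeasurableSpace T] {ν : Measure T}
    [IsProbabilityMeasure ν] {f : T → ℝ} {b : ℝ} (hb : ∀ z, |f z| ≤ b) : |∫ z, f z ∂ν| ≤ b := by
  have := norm_integral_le_of_norm_le_const (μ := ν) (C := b) (f := f) (ae_of_all _ hb)
  simpa using this

/-- A quantitative second-order expansion of the characteristic function of a centred, bounded
random variable. -/
lemma norm_charFun_centred_sub_le {T : Type*} [MeasurableSpace T] (ν : Measure T)
    [IsProbabilityMeasure ν] {f : T → ℝ} (hf : Measurable f) {b : ℝ} (hb : ∀ z, |f z| ≤ b)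
    (w : ℝ) :
    ‖(∫ z, Complex.exp (((w * (f z - ∫ y, f y ∂ν) : ℝ) : ℂ) * Complex.I) ∂ν)
        - ((1 - w ^ 2 / 2 * ((∫ z, f z ^ 2 ∂ν) - (∫ z, f z ∂ν) ^ 2) : ℝ) : ℂ)‖
      ≤ 4 * (2 * |w| * b) ^ 3 := by
  set m := ∫ y, f y ∂ν with hm
  have hmb : |m| ≤ b := abs_integral_le_of_abs_le hb
  have hif : Integrable f ν := integrable_of_measurable_abs_le hf hb
  have hif2 : Integrable (fun z => f z ^ 2) ν :=
    integrable_of_measurable_abs_le (hf.pow_const 2) (b := b ^ 2) fun z => by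
      rw [abs_pow]; gcongr; exact hb z
  have hx : ∀ z, |w * (f z - m)| ≤ 2 * |w| * b := fun z => by
    rw [abs_mul]
    have := abs_sub (f z) m
    nlinarith [abs_nonneg w, hb z]
  have hxm : Measurable fun z => w * (f z - m) := (hf.sub_const m).const_mul w
  have hi1 : Integrable (fun z => Complex.exp (((w * (f z - m) : ℝ) : ℂ) * Complex.I)) ν :=
    Integrable.of_bound (by fun_prop) 1 (ae_of_all _ fun z => (Complex.norm_exp_ofReal_mul_I _).le)
  -- Centring kills the linear term of the Taylor polynomial, and the quadratic term integrates to
  -- the variance.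
  have hq : (∫ z, ((1 : ℂ) + ((w * (f z - m) : ℝ) : ℂ) * Complex.I
      - ((w * (f z - m) : ℝ) : ℂ) ^ 2 / 2) ∂ν)
      = ((1 - w ^ 2 / 2 * ((∫ z, f z ^ 2 ∂ν) - m ^ 2) : ℝ) : ℂ) := by
    have hj1 : Integrable (fun z => w * (f z - m)) ν := integrable_of_measurable_abs_le hxm hx
    have hj2 : Integrable (fun z => (w * (f z - m)) ^ 2) ν :=
      integrable_of_measurable_abs_le (hxm.pow_const 2) (b := (2 * |w| * b) ^ 2) fun z => by
        rw [abs_pow]; gcongr; exact hx z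
    have e1 : ∫ z, w * (f z - m) ∂ν = 0 := by
      rw [integral_const_mul, integral_sub hif (integrable_const _)]; simp [hm]
    have e2 : ∫ z, (w * (f z - m)) ^ 2 ∂ν = w ^ 2 * ((∫ z, f z ^ 2 ∂ν) - m ^ 2) := by
      have : ∀ z, (w * (f z - m)) ^ 2 = w ^ 2 * (f z ^ 2 - 2 * m * f z + m ^ 2) := fun z => by ring
      simp_rw [this]
      have hif' : Integrable (fun z => 2 * m * f z) ν := hif.const_mul _
      have hif3 : Integrable (fun z => f z ^ 2 - 2 * m * f z) ν := hif2.sub hif'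
      rw [integral_const_mul, integral_add hif3 (integrable_const _),
        integral_sub hif2 hif', integral_const_mul, ← hm]
      simp only [integral_const, probReal_univ, smul_eq_mul, one_mul]
      ring
    have e1' : ∫ z, ((w * (f z - m) : ℝ) : ℂ) ∂ν = 0 := by
      rw [integral_complex_ofReal, e1, Complex.ofReal_zero]
    rw [integral_sub, integral_add (integrable_const _), integral_mul_const, e1', integral_div]
    · have : ∀ z, ((w * (f z - m) : ℝ) : ℂ) ^ 2 = (((w * (f z - m)) ^ 2 : ℝ) : ℂ) := fun z => by
        push_cast; rfl
      simp_rw [this]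
      rw [integral_complex_ofReal, e2]
      simp only [integral_const, probReal_univ]
      push_cast
      simp
      ring
    · exact hj1.ofReal.mul_const _
    · exact (integrable_const _).add (hj1.ofReal.mul_const _)
    · have := (hj2.ofReal (𝕜 := ℂ)).div_const 2
      simpa using this
  rw [← hq, ← integral_sub hi1]
  · refine (norm_integral_le_of_norm_le_const (C := 4 * (2 * |w| * b) ^ 3)
      (ae_of_all _ fun z => ?_)).trans (by simp)
    refine (norm_cexp_mul_I_sub_quadratic_le _).trans ?_
    gcongr
    exact hx z
  · refine Integrable.of_bound (by fun_prop) (1 + 2 * |w| * b + (2 * |w| * b) ^ 2 / 2)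
      (ae_of_all _ fun z => ?_)
    refine (norm_sub_le _ _).trans ?_
    gcongr
    · refine (norm_add_le _ _).trans ?_
      rw [norm_one, norm_mul, Complex.norm_I, mul_one, Complex.norm_real]
      gcongr
      exact hx z
    · rw [norm_div, norm_pow, Complex.norm_real]
      have := hx z
      simp only [Complex.norm_ofNat, Real.norm_eq_abs]
      gcongr

/-- A quantitative central limit theorem for the characteristic function of a normalised sum of
`n` independent copies of a bounded random variable; `v` need not be the exact variance. -/
lemma norm_charFun_pow_sub_gaussian_le {T : Type*} [MeasurableSpace T] (ν : Measure T)
    [IsProbabilityMeasure ν] {f : T → ℝ} (hf : Measurable f) {b : ℝ} (hb : ∀ z, |f z| ≤ b)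
    (u : ℝ) {v : ℝ} (hv : 0 ≤ v) {n : ℕ} (hn : 1 ≤ n) :
    ‖(∫ z, Complex.exp (((u / √n * (f z - ∫ y, f y ∂ν) : ℝ) : ℂ) * Complex.I) ∂ν) ^ n
        - (Real.exp (-(u ^ 2 * v / 2)) : ℂ)‖
      ≤ 4 * (2 * |u| * b) ^ 3 / √n
        + u ^ 2 / 2 * |(∫ z, f z ^ 2 ∂ν) - (∫ z, f z ∂ν) ^ 2 - v| + (u ^ 2 * v / 2) ^ 2 / n := by
  have hn0 : (0 : ℝ) < n := by exact_mod_cast hn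
  have hs0 : 0 < √(n : ℝ) := Real.sqrt_pos.2 hn0
  have hss : √(n : ℝ) ^ 2 = n := Real.sq_sqrt hn0.le
  set ψ := ∫ z, Complex.exp (((u / √n * (f z - ∫ y, f y ∂ν) : ℝ) : ℂ) * Complex.I) ∂ν with hψ
  set s := (∫ z, f z ^ 2 ∂ν) - (∫ z, f z ∂ν) ^ 2 with hs
  have h1 : ‖ψ - ((1 - (u / √n) ^ 2 / 2 * s : ℝ) : ℂ)‖ ≤ 4 * (2 * |u / √n| * b) ^ 3 :=
    norm_charFun_centred_sub_le ν hf hb _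
  -- The Gaussian value is itself the n-th power of exp(-y), so it suffices to compare single
  -- factors, along ψ, 1 - (u/√n)² s/2, 1 - y, exp(-y), and to multiply the total cost by n.
  set y := u ^ 2 * v / 2 / n with hy
  have hy0 : 0 ≤ y := by positivity
  have hexp : (Real.exp (-(u ^ 2 * v / 2)) : ℂ) = (Real.exp (-y) : ℂ) ^ n := by
    rw [← Complex.ofReal_pow, ← Real.exp_nat_mul]
    congr 2
    rw [hy]; field_simp
  have h2 : ‖((1 - y : ℝ) : ℂ) - (Real.exp (-y) : ℂ)‖ ≤ y ^ 2 := by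
    rw [← Complex.ofReal_sub, Complex.norm_real, norm_sub_rev]
    exact abs_exp_neg_sub_one_add_le hy0
  have h3 : ‖((1 - (u / √n) ^ 2 / 2 * s : ℝ) : ℂ) - ((1 - y : ℝ) : ℂ)‖ = u ^ 2 / 2 / n * |s - v| := by
    rw [← Complex.ofReal_sub, Complex.norm_real, Real.norm_eq_abs]
    have : 1 - (u / √n) ^ 2 / 2 * s - (1 - y) = -(u ^ 2 / 2 / n * (s - v)) := by
      rw [div_pow, hss, hy]; ring
    rw [this, abs_neg, abs_mul, abs_of_nonneg (by positivity)]
  have h4 : ‖ψ - (Real.exp (-y) : ℂ)‖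
      ≤ 4 * (2 * |u / √n| * b) ^ 3 + u ^ 2 / 2 / n * |s - v| + y ^ 2 := by
    calc ‖ψ - (Real.exp (-y) : ℂ)‖
        = ‖(ψ - ((1 - (u / √n) ^ 2 / 2 * s : ℝ) : ℂ))
          + (((1 - (u / √n) ^ 2 / 2 * s : ℝ) : ℂ) - ((1 - y : ℝ) : ℂ))
          + (((1 - y : ℝ) : ℂ) - (Real.exp (-y) : ℂ))‖ := by congr 1; ring
      _ ≤ _ := (norm_add₃_le).trans (by rw [h3]; gcongr)
  rw [hexp]
  refine (norm_pow_sub_pow_le_mul (norm_integral_cexp_mul_I_le_one ν _) ?_ n).trans ?_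
  · rw [Complex.norm_real, Real.norm_eq_abs, abs_of_pos (Real.exp_pos _)]
    exact Real.exp_le_one_iff.2 (by linarith)
  · refine (mul_le_mul_of_nonneg_left h4 hn0.le).trans (le_of_eq ?_)
    rw [abs_div, abs_of_pos hs0, hy]
    have h3 : √(n : ℝ) ^ 3 = n * √n := by rw [pow_succ, hss]
    have : (2 * (|u| / √n) * b) ^ 3 = (2 * |u| * b) ^ 3 / (n * √n) := by
      rw [← h3]; ring
    rw [this]
    field_simp

variable {S : Type*} [MeasurableSpace S]

/-! ### Test functions -/

namespace IsTestFunction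

lemma const (c : ℝ) : IsTestFunction fun _ : S => c :=
  ⟨measurable_const, |c|, fun _ => le_rfl⟩

lemma add {φ ψ : S → ℝ} (hφ : IsTestFunction φ) (hψ : IsTestFunction ψ) :
    IsTestFunction fun x => φ x + ψ x := by
  obtain ⟨h1, M1, b1⟩ := hφ
  obtain ⟨h2, M2, b2⟩ := hψ
  exact ⟨h1.add h2, M1 + M2, fun x => (abs_add_le _ _).trans (add_le_add (b1 x) (b2 x))⟩

lemma mul {φ ψ : S → ℝ} (hφ : IsTestFunction φ) (hψ : IsTestFunction ψ) :
    IsTestFunction fun x => φ x * ψ x := by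
  obtain ⟨h1, M1, b1⟩ := hφ
  obtain ⟨h2, M2, b2⟩ := hψ
  refine ⟨h1.mul h2, M1 * M2, fun x => ?_⟩
  rw [abs_mul]
  exact mul_le_mul (b1 x) (b2 x) (abs_nonneg _) ((abs_nonneg _).trans (b1 x))

lemma const_mul {φ : S → ℝ} (hφ : IsTestFunction φ) (c : ℝ) : IsTestFunction fun x => c * φ x :=
  (const c).mul hφ

lemma sub_const {φ : S → ℝ} (hφ : IsTestFunction φ) (c : ℝ) : IsTestFunction fun x => φ x - c := by
  simpa [sub_eq_add_neg] using hφ.add (const (-c))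

lemma sq {φ : S → ℝ} (hφ : IsTestFunction φ) : IsTestFunction fun x => φ x ^ 2 := by
  simpa [_root_.sq] using hφ.mul hφ

lemma integrable {φ : S → ℝ} (hφ : IsTestFunction φ) (μ : Measure S) [IsFiniteMeasure μ] :
    Integrable φ μ :=
  integrable_of_measurable_abs_le hφ.1 hφ.2.choose_spec

lemma exists_pos_bound {φ : S → ℝ} (hφ : IsTestFunction φ) : ∃ M > 0, ∀ x, |φ x| ≤ M := by
  obtain ⟨-, M, hM⟩ := hφ
  exact ⟨max M 1, by positivity, fun x => (hM x).trans (le_max_left _ _)⟩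

lemma integral_kernel {φ : S → ℝ} (hφ : IsTestFunction φ) (k : Kernel S S) [IsMarkovKernel k] :
    IsTestFunction fun x => ∫ y, φ y ∂k x := by
  obtain ⟨h1, M, hM⟩ := hφ
  exact ⟨h1.stronglyMeasurable.integral_kernel.measurable, M, fun x => abs_integral_le_of_abs_le hM⟩

end IsTestFunction

lemma integral_pos_of_forall_pos (μ : Measure S) [IsProbabilityMeasure μ] {φ : S → ℝ}
    (hφ : IsTestFunction φ) (h : ∀ x, 0 < φ x) : 0 < ∫ x, φ x ∂μ := by
  rw [integral_pos_iff_support_of_nonneg (fun x => (h x).le) (hφ.integrable μ)]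
  have : Function.support φ = Set.univ := by
    ext x; simp [(h x).ne']
  simp [this]

lemma sq_integral_le_integral_sq (μ : Measure S) [IsProbabilityMeasure μ] {φ : S → ℝ}
    (hφ : IsTestFunction φ) : (∫ x, φ x ∂μ) ^ 2 ≤ ∫ x, φ x ^ 2 ∂μ := by
  have := variance_nonneg φ μ
  rw [variance_eq_sub (MemLp.of_bound hφ.1.aestronglyMeasurable _
    (ae_of_all _ hφ.2.choose_spec))] at this
  simpa using this

/-! ### The limiting flow -/

/-- `pathIntegral` peels off the first transition, whereas the recursions in t need the last one;
the starting time is kept general so that the induction can move between the two. -/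
lemma pathIntegral_succ (K : ℕ → Kernel S S) (g : ℕ → S → ℝ) (φ : S → ℝ) (n t : ℕ) (x : S) :
    pathIntegral K g φ (n + 1) t x = pathIntegral K g (Qop K g (t + n) φ) n t x := by
  induction n generalizing t x with
  | zero => rfl
  | succ n ih =>
    rw [pathIntegral, pathIntegral]
    simp_rw [ih (t + 1)]
    rw [add_assoc, add_comm 1 n]

lemma gammaTarget_zero (π₀ : Measure S) (K : ℕ → Kernel S S) (g : ℕ → S → ℝ) (φ : S → ℝ) :
    gammaTarget π₀ K g 0 φ = ∫ x, φ x ∂π₀ := rfl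

lemma gammaTarget_succ (π₀ : Measure S) (K : ℕ → Kernel S S) (g : ℕ → S → ℝ) (t : ℕ)
    (φ : S → ℝ) : gammaTarget π₀ K g (t + 1) φ = gammaTarget π₀ K g t (Qop K g t φ) := by
  simp only [gammaTarget, pathIntegral_succ, zero_add]

/-- The potentials are measurable, positive and uniformly bounded. -/
structure IsPotential (g : ℕ → S → ℝ) (κ : ℝ) : Prop where
  measurable : ∀ t, Measurable (g t)
  pos : ∀ t x, 0 < g t x
  le : ∀ t x, g t x ≤ κ

section Flow

variable {π₀ : Measure S} [IsProbabilityMeasure π₀] {K : ℕ → Kernel S S}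
  [∀ t, IsMarkovKernel (K t)] {g : ℕ → S → ℝ} {κ : ℝ} {C : ℕ}

lemma IsPotential.isTestFunction (hg : IsPotential g κ) (t : ℕ) : IsTestFunction (g t) :=
  ⟨hg.measurable t, κ, fun x => by rw [abs_of_pos (hg.pos t x)]; exact hg.le t x⟩

lemma IsTestFunction.qop (hg : IsPotential g κ) {φ : S → ℝ} (hφ : IsTestFunction φ) (t : ℕ) :
    IsTestFunction (Qop K g t φ) :=
  (hg.isTestFunction t).mul (hφ.integral_kernel _)

lemma IsTestFunction.qopSq (hg : IsPotential g κ) {φ : S → ℝ} (hφ : IsTestFunction φ) (t : ℕ) :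
    IsTestFunction (QopSq K g t φ) :=
  (hg.isTestFunction t).sq.mul (hφ.integral_kernel _)

lemma qop_add {φ ψ : S → ℝ} (hφ : IsTestFunction φ) (hψ : IsTestFunction ψ) (t : ℕ) :
    Qop K g t (fun x => φ x + ψ x) = fun x => Qop K g t φ x + Qop K g t ψ x := by
  ext x
  simp only [Qop]
  rw [integral_add (hφ.integrable _) (hψ.integrable _), mul_add]

omit [∀ t, IsMarkovKernel (K t)] in
lemma qop_const_mul (φ : S → ℝ) (c : ℝ) (t : ℕ) :
    Qop K g t (fun x => c * φ x) = fun x => c * Qop K g t φ x := by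
  ext x
  simp only [Qop]
  rw [integral_const_mul]
  ring

lemma qop_one (t : ℕ) : Qop K g t (fun _ => 1) = g t := by
  ext x
  simp [Qop]

lemma gammaTarget_add (hg : IsPotential g κ) {φ ψ : S → ℝ} (hφ : IsTestFunction φ)
    (hψ : IsTestFunction ψ) (t : ℕ) :
    gammaTarget π₀ K g t (fun x => φ x + ψ x)
      = gammaTarget π₀ K g t φ + gammaTarget π₀ K g t ψ := by
  induction t generalizing φ ψ with
  | zero =>
    simp only [gammaTarget_zero]
    exact integral_add (hφ.integrable _) (hψ.integrable _)
  | succ t ih =>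
    simp only [gammaTarget_succ]
    rw [qop_add hφ hψ, ih (hφ.qop hg t) (hψ.qop hg t)]

omit [IsProbabilityMeasure π₀] [∀ t, IsMarkovKernel (K t)] in
lemma gammaTarget_const_mul (φ : S → ℝ) (c : ℝ) (t : ℕ) :
    gammaTarget π₀ K g t (fun x => c * φ x) = c * gammaTarget π₀ K g t φ := by
  induction t generalizing φ with
  | zero =>
    simp only [gammaTarget_zero]
    exact integral_const_mul _ _
  | succ t ih =>
    simp only [gammaTarget_succ]
    rw [qop_const_mul, ih]

lemma gammaTarget_sub_const (hg : IsPotential g κ) {φ : S → ℝ} (hφ : IsTestFunction φ) (c : ℝ)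
    (t : ℕ) :
    gammaTarget π₀ K g t (fun x => φ x - c)
      = gammaTarget π₀ K g t φ - c * normConst π₀ K g t := by
  have := gammaTarget_add (π₀ := π₀) (K := K) hg hφ ((IsTestFunction.const (1 : ℝ)).const_mul (-c)) t
  rw [gammaTarget_const_mul] at this
  simpa [sub_eq_add_neg, normConst] using this

omit [IsProbabilityMeasure π₀] [∀ t, IsMarkovKernel (K t)] in
lemma gammaTarget_nonneg (hg : IsPotential g κ) {φ : S → ℝ} (h : ∀ x, 0 ≤ φ x) (t : ℕ) :
    0 ≤ gammaTarget π₀ K g t φ := by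
  induction t generalizing φ with
  | zero => exact integral_nonneg h
  | succ t ih =>
    rw [gammaTarget_succ]
    exact ih fun x => mul_nonneg (hg.pos t x).le (integral_nonneg h)

lemma gammaTarget_pos (hg : IsPotential g κ) {φ : S → ℝ} (hφ : IsTestFunction φ)
    (h : ∀ x, 0 < φ x) (t : ℕ) : 0 < gammaTarget π₀ K g t φ := by
  induction t generalizing φ with
  | zero => exact integral_pos_of_forall_pos _ hφ h
  | succ t ih =>
    rw [gammaTarget_succ]
    exact ih (hφ.qop hg t) fun x => mul_pos (hg.pos t x) (integral_pos_of_forall_pos _ hφ h)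

lemma normConst_pos (hg : IsPotential g κ) (t : ℕ) : 0 < normConst π₀ K g t :=
  gammaTarget_pos hg (IsTestFunction.const 1) (fun _ => one_pos) t

omit [IsProbabilityMeasure π₀] in
lemma normConst_succ (t : ℕ) : normConst π₀ K g (t + 1) = gammaTarget π₀ K g t (g t) := by
  rw [normConst, gammaTarget_succ, qop_one]

lemma normConst_mul_piTarget (hg : IsPotential g κ) (t : ℕ) (φ : S → ℝ) :
    normConst π₀ K g t * piTarget π₀ K g t φ = gammaTarget π₀ K g t φ := by
  have := (normConst_pos (π₀ := π₀) (K := K) hg t).ne'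
  rw [piTarget]; field_simp

lemma gammaTarget_sub_piTarget (hg : IsPotential g κ) {φ : S → ℝ} (hφ : IsTestFunction φ) (t : ℕ) :
    gammaTarget π₀ K g t (fun x => φ x - piTarget π₀ K g t φ) = 0 := by
  rw [gammaTarget_sub_const hg hφ, mul_comm, normConst_mul_piTarget hg, sub_self]

/-- Cauchy-Schwarz for the positive linear functional γ_t, obtained from γ_t((Zφ - c)²) ≥ 0 with c =
γ_t(φ). -/
lemma sq_gammaTarget_le (hg : IsPotential g κ) {φ : S → ℝ} (hφ : IsTestFunction φ) (t : ℕ) :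
    gammaTarget π₀ K g t φ ^ 2 ≤ normConst π₀ K g t * gammaTarget π₀ K g t (fun x => φ x ^ 2) := by
  have hZ := normConst_pos (π₀ := π₀) (K := K) hg t
  set Z := normConst π₀ K g t
  set c := gammaTarget π₀ K g t φ with hc
  have h0 := gammaTarget_nonneg (π₀ := π₀) (K := K) hg
    (φ := fun x => (Z * φ x - c) ^ 2) (fun x => sq_nonneg _) t
  have e : (fun x => (Z * φ x - c) ^ 2)
      = fun x => (Z ^ 2 * φ x ^ 2 + (-2 * Z * c) * φ x) - (-c ^ 2) := by ext x; ring
  rw [e, gammaTarget_sub_const hg ((hφ.sq.const_mul _).add (hφ.const_mul _)),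
    gammaTarget_add hg (hφ.sq.const_mul _) (hφ.const_mul _), gammaTarget_const_mul,
    gammaTarget_const_mul, ← hc] at h0
  have : 0 ≤ Z * (Z * gammaTarget π₀ K g t (fun x => φ x ^ 2) - c ^ 2) := by
    linarith
  have := nonneg_of_mul_nonneg_right this hZ
  linarith

/-- Writing Z_{t+1}² π_{t+1}(φ) as γ_t(g_t) γ_t(Q φ) gives the form in which the second term arises,
as the limit of a product of two particle averages over distinct ancestors. -/
lemma muTarget_succ (hg : IsPotential g κ) (t : ℕ) (φ : S → ℝ) :
    muTarget π₀ K g C (t + 1) φ = 1 / (C : ℝ) * muTarget π₀ K g C t (QopSq K g t φ)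
      + ((C : ℝ) - 1) / C * (gammaTarget π₀ K g t (g t) * gammaTarget π₀ K g t (Qop K g t φ)) := by
  rw [muTarget, ← normConst_succ, ← gammaTarget_succ, ← normConst_mul_piTarget hg (t + 1) φ]
  ring

lemma muTarget_mono (hg : IsPotential g κ) (hC : 1 ≤ C) {φ ψ : S → ℝ} (hφ : IsTestFunction φ)
    (hψ : IsTestFunction ψ) (h : ∀ x, φ x ≤ ψ x) (t : ℕ) :
    muTarget π₀ K g C t φ ≤ muTarget π₀ K g C t ψ := by
  induction t generalizing φ ψ with
  | zero => exact integral_mono (hφ.integrable _) (hψ.integrable _) h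
  | succ t ih =>
    have hC' : (1 : ℝ) ≤ C := by exact_mod_cast hC
    rw [muTarget_succ hg, muTarget_succ hg]
    have h1 : ∀ x, ∫ y, φ y ∂K (t + 1) x ≤ ∫ y, ψ y ∂K (t + 1) x := fun x =>
      integral_mono (hφ.integrable _) (hψ.integrable _) h
    have h2 : gammaTarget π₀ K g t (Qop K g t φ) ≤ gammaTarget π₀ K g t (Qop K g t ψ) := by
      have h3 := gammaTarget_nonneg (π₀ := π₀) (K := K) hg
        (φ := fun x => Qop K g t ψ x + (-1) * Qop K g t φ x)
        (fun x => by
          have := mul_le_mul_of_nonneg_left (h1 x) (hg.pos t x).le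
          simp only [Qop]; linarith) t
      rw [gammaTarget_add hg (hψ.qop hg t) ((hφ.qop hg t).const_mul _), gammaTarget_const_mul] at h3
      linarith
    have h3 := ih (hφ.qopSq (K := K) hg t) (hψ.qopSq hg t) fun x =>
      mul_le_mul_of_nonneg_left (h1 x) (sq_nonneg _)
    have h4 : 0 ≤ ((C : ℝ) - 1) / C := div_nonneg (by linarith) (by linarith)
    have h5 := (gammaTarget_pos (π₀ := π₀) (K := K) hg (hg.isTestFunction t) (hg.pos t) t).le
    gcongr

/-- This is the non-negativity of the variance added at each step. The recursion for μ is a convex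
combination with weights 1/C and (C-1)/C, and each part dominates γ_{t+1}(φ)²: the first by
induction applied to Q φ together with Jensen's inequality (Kφ)² ≤ K(φ²), the second by
Cauchy-Schwarz for γ_{t+1}. -/
lemma sq_gammaTarget_le_muTarget (hg : IsPotential g κ) (hC : 1 ≤ C) {φ : S → ℝ}
    (hφ : IsTestFunction φ) (t : ℕ) :
    gammaTarget π₀ K g t φ ^ 2 ≤ muTarget π₀ K g C t (fun x => φ x ^ 2) := by
  induction t generalizing φ with
  | zero => exact sq_integral_le_integral_sq _ hφ
  | succ t ih =>
    have hC' : (1 : ℝ) ≤ C := by exact_mod_cast hC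
    rw [muTarget_succ hg]
    have h1 : gammaTarget π₀ K g (t + 1) φ ^ 2
        ≤ muTarget π₀ K g C t (QopSq K g t (fun x => φ x ^ 2)) := by
      rw [gammaTarget_succ]
      refine (ih (hφ.qop hg t)).trans
        (muTarget_mono hg hC (hφ.qop hg t).sq (hφ.sq.qopSq hg t) (fun x => ?_) t)
      simp only [Qop, QopSq, mul_pow]
      exact mul_le_mul_of_nonneg_left (sq_integral_le_integral_sq _ hφ) (sq_nonneg _)
    have h2 := sq_gammaTarget_le (π₀ := π₀) (K := K) hg hφ (t + 1)
    rw [normConst_succ, gammaTarget_succ _ _ _ _ (fun x => φ x ^ 2)] at h2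
    have h3 : 0 ≤ ((C : ℝ) - 1) / C := div_nonneg (by linarith) (by linarith)
    have h4 : 0 ≤ 1 / (C : ℝ) := by positivity
    have h5 : 1 / (C : ℝ) + ((C : ℝ) - 1) / C = 1 := by field_simp; ring
    calc gammaTarget π₀ K g (t + 1) φ ^ 2
        = 1 / (C : ℝ) * gammaTarget π₀ K g (t + 1) φ ^ 2
          + ((C : ℝ) - 1) / C * gammaTarget π₀ K g (t + 1) φ ^ 2 := by
          rw [← add_mul, h5, one_mul]
      _ ≤ _ := by gcongr

/-- The asymptotic variance of the particle approximation of `γ_t(φ)`. -/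
def asympVar (π₀ : Measure S) (K : ℕ → Kernel S S) (g : ℕ → S → ℝ) (C : ℕ) : ℕ → (S → ℝ) → ℝ
  | 0, φ => Var[φ; π₀]
  | t + 1, φ => asympVar π₀ K g C t (Qop K g t φ)
      + (muTarget π₀ K g C (t + 1) (fun x => φ x ^ 2) - gammaTarget π₀ K g (t + 1) φ ^ 2)

lemma asympVar_nonneg (hg : IsPotential g κ) (hC : 1 ≤ C) {φ : S → ℝ} (hφ : IsTestFunction φ)
    (t : ℕ) : 0 ≤ asympVar π₀ K g C t φ := by
  induction t generalizing φ with
  | zero => exact variance_nonneg _ _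
  | succ t ih =>
    exact add_nonneg (ih (hφ.qop hg t)) (sub_nonneg.2 (sq_gammaTarget_le_muTarget hg hC hφ _))

end Flow

/-! ### Conditionally i.i.d. arrays -/

/-- Given `Y`, the variables `Z i` are independent with common law `ρ Y`. -/
def CondIID {Ω E T ι : Type*} [MeasurableSpace Ω] [MeasurableSpace E] [MeasurableSpace T]
    [Fintype ι] (P : Measure Ω) (Y : Ω → E) (Z : Ω → ι → T) (ρ : Kernel E T) : Prop :=
  ∀ (H : E → ℂ) (f : ι → E × T → ℂ) (M : ℝ), Measurable H → (∀ y, ‖H y‖ ≤ M) →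
    (∀ i, Measurable (f i)) → (∀ i p, ‖f i p‖ ≤ M) →
    ∫ ω, H (Y ω) * ∏ i, f i (Y ω, Z ω i) ∂P = ∫ ω, H (Y ω) * ∏ i, ∫ z, f i (Y ω, z) ∂ρ (Y ω) ∂P

namespace CondIID

variable {Ω E T : Type*} [MeasurableSpace Ω] [MeasurableSpace E] [MeasurableSpace T] {N : ℕ}
  {P : Measure Ω} [IsProbabilityMeasure P] {Y : Ω → E} {Z : Ω → Fin N → T} {ρ : Kernel E T}
  [IsMarkovKernel ρ]

omit [IsProbabilityMeasure P] [IsMarkovKernel ρ] in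
lemma integral_mul_eq_zero (h : CondIID P Y Z ρ) {c : E × T → ℝ} (hc : Measurable c) {M : ℝ}
    (hM : ∀ p, |c p| ≤ M) (h0 : ∀ y, ∫ z, c (y, z) ∂ρ y = 0) {i l : Fin N} (hil : i ≠ l) :
    ∫ ω, c (Y ω, Z ω i) * c (Y ω, Z ω l) ∂P = 0 := by
  -- The factor is c at the two indices i, l and 1 elsewhere; the bound `max M 1` covers both kinds
  -- of factor.
  have key := h (fun _ => 1) (fun j p => if j ∈ ({i, l} : Finset (Fin N)) then (c p : ℂ) else 1)
    (max M 1) measurable_const (fun _ => by simp)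
    (fun j => by split_ifs <;> fun_prop)
    (fun j p => by
      split_ifs
      · rw [Complex.norm_real]; exact (hM p).trans (le_max_left _ _)
      · simp)
  have e1 : ∀ ω, (1 : ℂ) * ∏ j, (if j ∈ ({i, l} : Finset (Fin N)) then (c (Y ω, Z ω j) : ℂ) else 1)
      = ((c (Y ω, Z ω i) * c (Y ω, Z ω l) : ℝ) : ℂ) := fun ω => by
    rw [Finset.prod_ite_mem, Finset.univ_inter, Finset.prod_pair hil]
    push_cast; ring
  have e2 : ∀ ω, (1 : ℂ) * ∏ j, (∫ z, (if j ∈ ({i, l} : Finset (Fin N)) then (c (Y ω, z) : ℂ)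
      else 1) ∂ρ (Y ω)) = 0 := fun ω => by
    rw [one_mul]
    refine Finset.prod_eq_zero (Finset.mem_univ i) ?_
    simp only [Finset.mem_insert, true_or, if_true]
    rw [integral_complex_ofReal, h0, Complex.ofReal_zero]
  simp only [e1, e2] at key
  rw [integral_complex_ofReal] at key
  simpa using key

/-- In the expanded square, the cross terms vanish by conditional independence and centring; N
diagonal terms remain, each at most (2M)². -/
lemma integral_sq_mean_sub_le (h : CondIID P Y Z ρ) (hY : Measurable Y) (hZ : Measurable Z)
    (hN : 1 ≤ N) {f : E × T → ℝ} (hf : Measurable f) {M : ℝ} (hM : ∀ p, |f p| ≤ M) :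
    ∫ ω, (1 / (N : ℝ) * ∑ i, f (Y ω, Z ω i) - ∫ z, f (Y ω, z) ∂ρ (Y ω)) ^ 2 ∂P
      ≤ (2 * M) ^ 2 / N := by
  have hN0 : (0 : ℝ) < N := by exact_mod_cast hN
  set m : E → ℝ := fun y => ∫ z, f (y, z) ∂ρ y with hm
  have hmm : Measurable m := hf.stronglyMeasurable.integral_kernel_prod_right'.measurable
  have hmb : ∀ y, |m y| ≤ M := fun y => abs_integral_le_of_abs_le fun z => hM _
  set c : E × T → ℝ := fun p => f p - m p.1 with hc
  have hcm : Measurable c := hf.sub (hmm.comp measurable_fst)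
  have hcb : ∀ p, |c p| ≤ 2 * M := fun p => by
    refine (abs_sub _ _).trans ?_
    linarith [hM p, hmb p.1]
  have hc0 : ∀ y, ∫ z, c (y, z) ∂ρ y = 0 := fun y => by
    simp only [hc]
    rw [integral_sub (integrable_of_measurable_abs_le (by fun_prop) fun z => hM _)
      (integrable_const _)]
    simp [hm]
  have hYZ : ∀ i, Measurable fun ω => (Y ω, Z ω i) := fun i =>
    hY.prodMk ((measurable_pi_apply i).comp hZ)
  have hcc : ∀ i l, ∀ ω, |c (Y ω, Z ω i) * c (Y ω, Z ω l)| ≤ (2 * M) ^ 2 := fun i l ω => by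
    rw [abs_mul, sq]
    exact mul_le_mul (hcb _) (hcb _) (abs_nonneg _) ((abs_nonneg _).trans (hcb (Y ω, Z ω i)))
  have hci : ∀ i l, Integrable (fun ω => c (Y ω, Z ω i) * c (Y ω, Z ω l)) P := fun i l =>
    integrable_of_measurable_abs_le ((hcm.comp (hYZ i)).mul (hcm.comp (hYZ l))) (hcc i l)
  have e : ∀ ω, (1 / (N : ℝ) * ∑ i, f (Y ω, Z ω i) - m (Y ω)) ^ 2
      = 1 / (N : ℝ) ^ 2 * ∑ i, ∑ l, c (Y ω, Z ω i) * c (Y ω, Z ω l) := fun ω => by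
    rw [← Finset.sum_mul_sum]
    simp only [hc, Finset.sum_sub_distrib, Finset.sum_const, Finset.card_univ, Fintype.card_fin,
      nsmul_eq_mul]
    field_simp
  have hb : ∀ i l, ∫ ω, c (Y ω, Z ω i) * c (Y ω, Z ω l) ∂P
      ≤ if i = l then (2 * M) ^ 2 else 0 := fun i l => by
    split_ifs with hil
    · exact (le_abs_self _).trans (abs_integral_le_of_abs_le (hcc i l))
    · exact (h.integral_mul_eq_zero hcm hcb hc0 hil).le
  calc ∫ ω, (1 / (N : ℝ) * ∑ i, f (Y ω, Z ω i) - m (Y ω)) ^ 2 ∂P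
      = 1 / (N : ℝ) ^ 2 * ∑ i, ∑ l, ∫ ω, c (Y ω, Z ω i) * c (Y ω, Z ω l) ∂P := by
        simp_rw [e]
        rw [integral_const_mul, integral_finsetSum _ fun i _ => integrable_finsetSum _ fun l _ =>
          hci i l]
        simp_rw [integral_finsetSum _ fun l _ => hci _ l]
    _ ≤ 1 / (N : ℝ) ^ 2 * ∑ i : Fin N, ∑ l : Fin N, if i = l then (2 * M) ^ 2 else 0 := by
        gcongr with i _ l _
        exact hb i l
    _ = (2 * M) ^ 2 / N := by
        simp
        field_simp

/-- One step of the central limit theorem, for characteristic functions: conditionally on `Y`, the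
centred and normalised sum is nearly Gaussian, and nearly independent of `Y` when its conditional
variance is nearly the constant `v`. -/
lemma norm_integral_cexp_sub_le (h : CondIID P Y Z ρ) (hY : Measurable Y) (hN : 1 ≤ N)
    {f : E × T → ℝ} (hf : Measurable f) {b : ℝ} (hb : ∀ p, |f p| ≤ b) {Θ : E → ℝ}
    (hΘ : Measurable Θ) (u : ℝ) {v : ℝ} (hv : 0 ≤ v) :
    ‖(∫ ω, Complex.exp (((Θ (Y ω) + u / √N * ∑ i, (f (Y ω, Z ω i) - ∫ z, f (Y ω, z) ∂ρ (Y ω)) : ℝ)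
          : ℂ) * Complex.I) ∂P)
        - (Real.exp (-(u ^ 2 * v / 2)) : ℂ) * ∫ ω, Complex.exp (Θ (Y ω) * Complex.I) ∂P‖
      ≤ 4 * (2 * |u| * b) ^ 3 / √N
        + u ^ 2 / 2 * ∫ ω, |(∫ z, f (Y ω, z) ^ 2 ∂ρ (Y ω)) - (∫ z, f (Y ω, z) ∂ρ (Y ω)) ^ 2 - v| ∂P
        + (u ^ 2 * v / 2) ^ 2 / N := by
  set m : E → ℝ := fun y => ∫ z, f (y, z) ∂ρ y with hm
  have hmm : Measurable m := hf.stronglyMeasurable.integral_kernel_prod_right'.measurable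
  have hmb : ∀ y, |m y| ≤ b := fun y => abs_integral_le_of_abs_le fun z => hb _
  set q : E → ℝ := fun y => ∫ z, f (y, z) ^ 2 ∂ρ y with hq
  have hqm : Measurable q :=
    (hf.pow_const 2).stronglyMeasurable.integral_kernel_prod_right'.measurable
  have hqb : ∀ y, |q y| ≤ b ^ 2 := fun y => abs_integral_le_of_abs_le fun z => by
    rw [abs_pow]; gcongr; exact hb _
  set F : E × T → ℂ := fun p => Complex.exp (((u / √N * (f p - m p.1) : ℝ) : ℂ) * Complex.I) with hF
  have hFm : Measurable F := by
    have : Measurable fun p : E × T => u / √N * (f p - m p.1) :=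
      (hf.sub (hmm.comp measurable_fst)).const_mul _
    fun_prop
  have hFb : ∀ p, ‖F p‖ = 1 := fun p => Complex.norm_exp_ofReal_mul_I _
  have hHm : Measurable fun y => Complex.exp (Θ y * Complex.I) := by fun_prop
  have hHb : ∀ y, ‖Complex.exp (Θ y * Complex.I)‖ = 1 := fun y => Complex.norm_exp_ofReal_mul_I _
  set ψ : E → ℂ := fun y => ∫ z, F (y, z) ∂ρ y with hψ
  have hψm : Measurable ψ := hFm.stronglyMeasurable.integral_kernel_prod_right'.measurable
  have hψb : ∀ y, ‖ψ y‖ ≤ 1 := fun y => norm_integral_cexp_mul_I_le_one _ _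
  -- With the same exponential in every factor, the conditional characteristic function of the sum
  -- is ψ(Y)^N, while exp(iΘ(Y)) stays outside as the function of Y.
  have key := h (fun y => Complex.exp (Θ y * Complex.I)) (fun _ => F) 1 hHm (fun y => (hHb y).le)
    (fun _ => hFm) (fun _ p => (hFb p).le)
  have e : ∀ ω, Complex.exp (((Θ (Y ω) + u / √N * ∑ i, (f (Y ω, Z ω i) - m (Y ω)) : ℝ)
      : ℂ) * Complex.I) = Complex.exp (Θ (Y ω) * Complex.I) * ∏ i, F (Y ω, Z ω i) := fun ω => by
    simp only [hF]
    rw [← Complex.exp_sum, ← Complex.exp_add, ← Finset.sum_mul, ← add_mul]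
    congr 2
    push_cast
    rw [Finset.mul_sum]
  simp only [Finset.prod_const, Finset.card_univ, Fintype.card_fin] at key
  change _ = ∫ ω, Complex.exp (Θ (Y ω) * Complex.I) * ψ (Y ω) ^ N ∂P at key
  change ‖(∫ ω, Complex.exp (((Θ (Y ω) + u / √N * ∑ i, (f (Y ω, Z ω i) - m (Y ω)) : ℝ) : ℂ)
    * Complex.I) ∂P) - _‖ ≤ _ + u ^ 2 / 2 * ∫ ω, |q (Y ω) - m (Y ω) ^ 2 - v| ∂P + _
  simp_rw [e]
  rw [key, ← integral_const_mul, ← integral_sub]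
  · have hvi : Integrable (fun ω => |q (Y ω) - m (Y ω) ^ 2 - v|) P := by
      refine integrable_of_measurable_abs_le
        (b := b ^ 2 + b ^ 2 + |v|) ?_ fun ω => ?_
      · exact (((hqm.comp hY).sub ((hmm.comp hY).pow_const 2)).sub_const v).abs
      · rw [abs_abs]
        refine (abs_sub _ _).trans ?_
        gcongr
        refine (abs_sub _ _).trans ?_
        gcongr
        · exact hqb _
        · rw [abs_pow]; gcongr; exact hmb _
    have hvi' : Integrable (fun ω => u ^ 2 / 2 * |q (Y ω) - m (Y ω) ^ 2 - v|) P := hvi.const_mul _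
    have hvi'' : Integrable (fun ω => 4 * (2 * |u| * b) ^ 3 / √N
        + u ^ 2 / 2 * |q (Y ω) - m (Y ω) ^ 2 - v|) P := (integrable_const _).add hvi'
    refine (norm_integral_le_of_norm_le (g := fun ω => 4 * (2 * |u| * b) ^ 3 / √N
      + u ^ 2 / 2 * |q (Y ω) - m (Y ω) ^ 2 - v| + (u ^ 2 * v / 2) ^ 2 / N) ?_
      (ae_of_all _ fun ω => ?_)).trans (le_of_eq ?_)
    · exact hvi''.add (integrable_const _)
    -- The i.i.d. bound is used pointwise in Y; exp(iΘ) has modulus one and does not affect it.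
    · have := norm_charFun_pow_sub_gaussian_le (ρ (Y ω)) (f := fun z => f (Y ω, z))
        (by fun_prop) (fun z => hb _) u hv hN
      rw [mul_comm _ (Complex.exp _), ← mul_sub, norm_mul, hHb, one_mul]
      exact this
    · rw [integral_add hvi'' (integrable_const _), integral_add (integrable_const _) hvi', integral_const_mul]
      simp
  · refine Integrable.of_bound (C := 1) ?_ (ae_of_all _ fun ω => ?_)
    · exact ((hHm.comp hY).mul ((hψm.comp hY).pow_const N)).aestronglyMeasurable
    · rw [norm_mul, hHb, one_mul, norm_pow]
      exact pow_le_one₀ (norm_nonneg _) (hψb _)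
  · refine Integrable.of_bound (C := 1) ?_ (ae_of_all _ fun ω => ?_)
    · exact ((hHm.comp hY).const_mul _).aestronglyMeasurable
    · rw [norm_mul, hHb, mul_one, Complex.norm_real, Real.norm_eq_abs, abs_of_pos (Real.exp_pos _)]
      exact Real.exp_le_one_iff.2 (by have : 0 ≤ u ^ 2 * v / 2 := by positivity
                                      linarith)

end CondIID

/-! ### The law of a row of the connectivity matrix -/

section Rows

variable {N C : ℕ}

lemma connRows_finite (N C : ℕ) : (connRows N C).Finite := by
  refine ((Finset.univ.powersetCard C).finite_toSet.image
    fun (s : Finset (Fin N)) => fun j => if j ∈ s then 1 / (C : ℝ) else 0).subset ?_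
  rintro r ⟨s, hs, rfl⟩
  exact ⟨s, by simp [hs], rfl⟩

lemma connRows_nonempty (hCN : C ≤ N) : (connRows N C).Nonempty := by
  obtain ⟨s, -, hs⟩ := Finset.exists_subset_card_eq (s := (Finset.univ : Finset (Fin N))) (n := C)
    (by simpa using hCN)
  exact ⟨_, s, hs, rfl⟩

lemma isProbabilityMeasure_uniformOn_connRows (hCN : C ≤ N) :
    IsProbabilityMeasure (uniformOn (connRows N C)) :=
  isProbabilityMeasure_uniformOn (connRows_finite N C) (connRows_nonempty hCN)

lemma ae_mem_connRows (N C : ℕ) : ∀ᵐ r ∂uniformOn (connRows N C), r ∈ connRows N C := by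
  have h : MeasurableSet (connRows N C) := (connRows_finite N C).measurableSet
  exact ae_cond_mem h

lemma connRows.nonneg {r : Fin N → ℝ} (hr : r ∈ connRows N C) (j : Fin N) : 0 ≤ r j := by
  obtain ⟨s, -, rfl⟩ := hr
  dsimp only
  split_ifs <;> positivity

lemma connRows.sum_eq_one (hC : 1 ≤ C) {r : Fin N → ℝ} (hr : r ∈ connRows N C) :
    ∑ j, r j = 1 := by
  obtain ⟨s, hs, rfl⟩ := hr
  have : (C : ℝ) ≠ 0 := by positivity
  simp [hs, this]

/-- The entries are 0 or 1/C, so squaring is multiplication by 1/C. This is the origin of the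
coefficient 1/C in μ_t. -/
lemma connRows.mul_self {r : Fin N → ℝ} (hr : r ∈ connRows N C) (j : Fin N) :
    r j * r j = 1 / (C : ℝ) * r j := by
  obtain ⟨s, -, rfl⟩ := hr
  dsimp only
  split_ifs <;> simp

lemma connRows.comp_perm {r : Fin N → ℝ} (hr : r ∈ connRows N C) (σ : Equiv.Perm (Fin N)) :
    r ∘ σ ∈ connRows N C := by
  obtain ⟨s, hs, rfl⟩ := hr
  refine ⟨s.map σ.symm.toEmbedding, by simpa using hs, ?_⟩
  ext j
  simp

lemma connRows.weighted_sum_pos (hC : 1 ≤ C) {r : Fin N → ℝ} (hr : r ∈ connRows N C)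
    {v : Fin N → ℝ} (hv : ∀ j, 0 < v j) : 0 < ∑ j, r j * v j := by
  obtain ⟨j, hj⟩ : ∃ j, r j ≠ 0 := by
    by_contra! h
    have := connRows.sum_eq_one hC hr
    simp [h] at this
  exact Finset.sum_pos' (fun i _ => mul_nonneg (connRows.nonneg hr i) (hv i).le)
    ⟨j, Finset.mem_univ _, mul_pos ((connRows.nonneg hr j).lt_of_ne' hj) (hv j)⟩

lemma connRows.weighted_sum_le (hC : 1 ≤ C) {r : Fin N → ℝ} (hr : r ∈ connRows N C)
    {v : Fin N → ℝ} {b : ℝ} (hv : ∀ j, v j ≤ b) : ∑ j, r j * v j ≤ b := by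
  calc ∑ j, r j * v j ≤ ∑ j, r j * b :=
        Finset.sum_le_sum fun j _ => mul_le_mul_of_nonneg_left (hv j) (connRows.nonneg hr j)
    _ = b := by rw [← Finset.sum_mul, connRows.sum_eq_one hC hr, one_mul]

lemma integrableOn_count_of_finite {T : Type*} [MeasurableSpace T] [MeasurableSingletonClass T]
    {s : Set T} (hs : s.Finite) (h : T → ℝ) : IntegrableOn h s Measure.count := by
  have : IsFiniteMeasure (Measure.count.restrict s) :=
    ⟨by simpa using Measure.count_apply_lt_top.2 hs⟩
  have h1 := IntegrableOn.of_finite (μ := Measure.count.restrict s) hs (f := h)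
  rwa [IntegrableOn, Measure.restrict_restrict hs.measurableSet, Set.inter_self] at h1

lemma integrable_uniformOn_connRows (h : (Fin N → ℝ) → ℝ) :
    Integrable h (uniformOn (connRows N C)) := by
  -- For C > N there are no rows, and `uniformOn` of the empty set is the zero measure.
  rcases Set.eq_empty_or_nonempty (connRows N C) with h0 | h0
  · rw [h0, uniformOn_empty_meas]; exact integrable_zero_measure
  · unfold uniformOn ProbabilityTheory.cond
    refine (integrableOn_count_of_finite (connRows_finite N C) h).smul_measure ?_
    simpa using Set.nonempty_iff_ne_empty.1 h0

lemma integral_uniformOn_connRows (h : (Fin N → ℝ) → ℝ) :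
    ∫ r, h r ∂uniformOn (connRows N C)
      = ((Measure.count (connRows N C))⁻¹).toReal
        * ∑ r ∈ (connRows_finite N C).toFinset, h r := by
  have hf := connRows_finite N C
  unfold uniformOn ProbabilityTheory.cond
  rw [integral_smul_measure, smul_eq_mul]
  congr 1
  have e : connRows N C = hf.toFinset := by simp
  conv_lhs => rw [e]
  rw [setIntegral_finset _ (integrableOn_count_of_finite (Finset.finite_toSet _) h)]
  simp [Measure.real]

/-- A permutation of the positions permutes the finite set of rows. This exchangeability, the row
sum 1 and `connRows.mul_self` determine the first two moments of a row, with no counting of subsets.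
-/
lemma integral_uniformOn_connRows_comp_perm (h : (Fin N → ℝ) → ℝ) (σ : Equiv.Perm (Fin N)) :
    ∫ r, h (r ∘ σ) ∂uniformOn (connRows N C) = ∫ r, h r ∂uniformOn (connRows N C) := by
  rw [integral_uniformOn_connRows, integral_uniformOn_connRows]
  congr 1
  refine Finset.sum_nbij' (fun r => r ∘ σ) (fun r => r ∘ σ.symm) ?_ ?_ ?_ ?_ ?_
  · intro r hr; simp only [Set.Finite.mem_toFinset] at *; exact connRows.comp_perm hr σ
  · intro r hr; simp only [Set.Finite.mem_toFinset] at *; exact connRows.comp_perm hr σ.symm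
  · intro r _; ext j; simp
  · intro r _; ext j; simp
  · intro r _; rfl

/-- The N expectations are equal by exchangeability and sum to 1. -/
lemma integral_connRows_apply (hC : 1 ≤ C) (hCN : C ≤ N) (j : Fin N) :
    ∫ r, r j ∂uniformOn (connRows N C) = 1 / (N : ℝ) := by
  have := isProbabilityMeasure_uniformOn_connRows hCN
  have hN : (N : ℝ) ≠ 0 := by have : 1 ≤ N := hC.trans hCN; positivity
  have h1 : ∀ k, ∫ r, r k ∂uniformOn (connRows N C) = ∫ r, r j ∂uniformOn (connRows N C) :=
    fun k => by
      rw [← integral_uniformOn_connRows_comp_perm (fun r => r k) (Equiv.swap k j)]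
      simp
  have h2 : ∑ k, ∫ r, r k ∂uniformOn (connRows N C) = 1 := by
    rw [← integral_finsetSum _ fun k _ => integrable_uniformOn_connRows _,
      integral_congr_ae (g := fun _ => 1)]
    · simp
    · filter_upwards [ae_mem_connRows N C] with r hr using connRows.sum_eq_one hC hr
  simp only [h1, Finset.sum_const, Finset.card_univ, Fintype.card_fin, nsmul_eq_mul] at h2
  field_simp
  linarith

lemma integral_connRows_apply_mul_self (hC : 1 ≤ C) (hCN : C ≤ N) (j : Fin N) :
    ∫ r, r j * r j ∂uniformOn (connRows N C) = 1 / (C : ℝ) * (1 / N) := by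
  rw [← integral_connRows_apply hC hCN j, ← integral_const_mul]
  refine integral_congr_ae ?_
  filter_upwards [ae_mem_connRows N C] with r hr using connRows.mul_self hr j

/-- Since the row sums to 1, the numbers E r_j r_l add up over l to E r_j = 1/N; removing the
diagonal term 1/(CN) leaves N - 1 equal terms. -/
lemma integral_connRows_apply_mul (hC : 1 ≤ C) (hCN : C ≤ N) {j k : Fin N} (hjk : j ≠ k) :
    ∫ r, r j * r k ∂uniformOn (connRows N C) = ((C : ℝ) - 1) / (C * (N * (N - 1))) := by
  have hN : 2 ≤ N := by
    by_contra! h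
    exact hjk (Fin.ext (by omega))
  have hN' : (2 : ℝ) ≤ N := by exact_mod_cast hN
  have hN0 : (N : ℝ) - 1 ≠ 0 := by linarith
  have hC0 : (C : ℝ) ≠ 0 := by positivity
  have h1 : ∀ l ∈ Finset.univ.erase j, ∫ r, r j * r l ∂uniformOn (connRows N C)
      = ∫ r, r j * r k ∂uniformOn (connRows N C) := fun l hl => by
    have hl : l ≠ j := Finset.ne_of_mem_erase hl
    rw [← integral_uniformOn_connRows_comp_perm (fun r => r j * r l) (Equiv.swap l k)]
    simp [Equiv.swap_apply_of_ne_of_ne hl.symm hjk]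
  have h2 : ∑ l, ∫ r, r j * r l ∂uniformOn (connRows N C) = 1 / (N : ℝ) := by
    rw [← integral_finsetSum _ fun k _ => integrable_uniformOn_connRows _,
      ← integral_connRows_apply hC hCN j]
    refine integral_congr_ae ?_
    filter_upwards [ae_mem_connRows N C] with r hr
    rw [← Finset.mul_sum, connRows.sum_eq_one hC hr, mul_one]
  rw [← Finset.add_sum_erase _ _ (Finset.mem_univ j), Finset.sum_congr rfl h1,
    integral_connRows_apply_mul_self hC hCN, Finset.sum_const, Finset.card_erase_of_mem
    (Finset.mem_univ j), Finset.card_univ, Fintype.card_fin, nsmul_eq_mul,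
    Nat.cast_sub (by omega), Nat.cast_one] at h2
  have : ((N : ℝ) - 1) * ∫ r, r j * r k ∂uniformOn (connRows N C)
      = 1 / (N : ℝ) - 1 / C * (1 / N) := by linarith
  rw [eq_div_iff (by positivity), ← mul_left_inj' (c := (1 : ℝ)) one_ne_zero]
  calc _ = (C * N) * (((N : ℝ) - 1) * ∫ r, r j * r k ∂uniformOn (connRows N C)) := by ring
    _ = _ := by rw [this]; field_simp

lemma integral_connRows_linear (hC : 1 ≤ C) (hCN : C ≤ N) (a : Fin N → ℝ) :
    ∫ r, ∑ j, r j * a j ∂uniformOn (connRows N C) = 1 / (N : ℝ) * ∑ j, a j := by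
  rw [integral_finsetSum _ fun k _ => integrable_uniformOn_connRows _, Finset.mul_sum]
  refine Finset.sum_congr rfl fun j _ => ?_
  rw [integral_mul_const, integral_connRows_apply hC hCN]

/-- Diagonal and off-diagonal pairs have different constants; the off-diagonal sum is written as the
product of the full sums minus the diagonal, so that particle averages can be recognised. -/
lemma integral_connRows_bilinear (hC : 1 ≤ C) (hCN : C ≤ N) (a b : Fin N → ℝ) :
    ∫ r, (∑ j, r j * a j) * ∑ j, r j * b j ∂uniformOn (connRows N C)
      = 1 / (C : ℝ) * (1 / N * ∑ j, a j * b j)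
        + ((C : ℝ) - 1) / (C * (N * (N - 1))) * ((∑ j, a j) * (∑ j, b j) - ∑ j, a j * b j) := by
  set c := ((C : ℝ) - 1) / (C * (N * (N - 1))) with hc
  have h1 : ∀ r : Fin N → ℝ, (∑ j, r j * a j) * ∑ j, r j * b j
      = ∑ j, ∑ k, r j * r k * (a j * b k) := fun r => by
    rw [Finset.sum_mul_sum]
    exact Finset.sum_congr rfl fun j _ => Finset.sum_congr rfl fun k _ => by ring
  simp_rw [h1]
  rw [integral_finsetSum _ fun k _ => integrable_uniformOn_connRows _]
  have h2 : ∀ j, ∫ r, ∑ k, r j * r k * (a j * b k) ∂uniformOn (connRows N C)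
      = (1 / (C : ℝ) * (1 / N) - c) * (a j * b j) + c * (a j * ∑ k, b k) := fun j => by
    rw [integral_finsetSum _ fun k _ => integrable_uniformOn_connRows _]
    have h3 : ∀ k, ∫ r, r j * r k * (a j * b k) ∂uniformOn (connRows N C)
        = (if j = k then (1 / (C : ℝ) * (1 / N) - c) * (a j * b k) else 0) + c * (a j * b k) :=
      fun k => by
        rw [integral_mul_const]
        split_ifs with hjk
        · rw [← hjk, integral_connRows_apply_mul_self hC hCN]; ring
        · rw [integral_connRows_apply_mul hC hCN hjk]; ring
    simp_rw [h3]
    rw [Finset.sum_add_distrib, Finset.sum_ite_eq, ← Finset.mul_sum, ← Finset.mul_sum]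
    simp
  simp_rw [h2]
  rw [Finset.sum_add_distrib, ← Finset.mul_sum, ← Finset.mul_sum, ← Finset.sum_mul]
  ring

end Rows

/-! ### Finite products of Markov kernels -/

section PiKernel

variable {ι A B : Type*} [Fintype ι] [MeasurableSpace A] [MeasurableSpace B]

/-- The product of finitely many Markov kernels with a common source. -/
def piKernel (κ : ι → Kernel A B) [∀ i, IsMarkovKernel (κ i)] : Kernel A (ι → B) where
  toFun a := Measure.pi fun i => κ i a
  measurable' := by
    refine Measurable.measure_of_isPiSystem_of_isProbabilityMeasure generateFrom_pi.symm
      isPiSystem_pi ?_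
    rintro _ ⟨s, hs, rfl⟩
    simp only [Measure.pi_pi]
    exact Finset.measurable_prod _ fun i _ => Kernel.measurable_coe _ (hs i trivial)

lemma piKernel_apply (κ : ι → Kernel A B) [∀ i, IsMarkovKernel (κ i)] (a : A) :
    piKernel κ a = Measure.pi fun i => κ i a := rfl

instance (κ : ι → Kernel A B) [∀ i, IsMarkovKernel (κ i)] : IsMarkovKernel (piKernel κ) :=
  ⟨fun a => by rw [piKernel_apply]; infer_instance⟩

/-- Products of a measurable set and a box form a π-system generating the product σ-algebra, so a
product formula for the conditional probabilities of boxes determines the joint law. -/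
lemma map_prod_eq_compProd_piKernel {Ω : Type*} [MeasurableSpace Ω] {P : Measure Ω}
    [IsProbabilityMeasure P] (κ : ι → Kernel A B) [∀ i, IsMarkovKernel (κ i)] {U : Ω → A}
    {X : Ω → ι → B} (hU : Measurable U) (hX : Measurable X)
    (h : ∀ (G : Set A) (s : ι → Set B), MeasurableSet G → (∀ i, MeasurableSet (s i)) →
      P ({ω | U ω ∈ G} ∩ {ω | ∀ i, X ω i ∈ s i}) = ∫⁻ ω in {ω | U ω ∈ G}, ∏ i, κ i (U ω) (s i) ∂P) :
    P.map (fun ω => (U ω, X ω)) = (P.map U) ⊗ₘ piKernel κ := by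
  have hUX : Measurable fun ω => (U ω, X ω) := hU.prodMk hX
  have := Measure.isProbabilityMeasure_map (μ := P) hU.aemeasurable
  have := Measure.isProbabilityMeasure_map (μ := P) hUX.aemeasurable
  refine ext_of_generate_finite
    (Set.image2 (· ×ˢ ·) {s : Set A | MeasurableSet s}
      (Set.univ.pi '' Set.univ.pi fun _ : ι => {s : Set B | MeasurableSet s}))
    ?_ ?_ ?_ (by simp)
  · refine (generateFrom_eq_prod MeasurableSpace.generateFrom_measurableSet generateFrom_pi
      isCountablySpanning_measurableSet ⟨fun _ => Set.univ, fun _ => ⟨fun _ => Set.univ, ?_, ?_⟩,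
        Set.iUnion_const _⟩).symm
    · simp
    · simp
  · exact MeasurableSpace.isPiSystem_measurableSet.prod isPiSystem_pi
  · rintro _ ⟨G, hG, _, ⟨s, hs, rfl⟩, rfl⟩
    have hs' : ∀ i, MeasurableSet (s i) := fun i => hs i trivial
    have hG : MeasurableSet G := hG
    dsimp only
    rw [Measure.compProd_apply_prod hG (MeasurableSet.univ_pi hs'),
      Measure.map_apply hUX (hG.prod (MeasurableSet.univ_pi hs')),
      setLIntegral_map hG (Kernel.measurable_coe _ (MeasurableSet.univ_pi hs')) hU]
    simp only [piKernel_apply, Measure.pi_pi]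
    have e : (fun ω => (U ω, X ω)) ⁻¹' (G ×ˢ Set.univ.pi s)
        = {ω | U ω ∈ G} ∩ {ω | ∀ i, X ω i ∈ s i} := by
      ext ω
      simp
    rw [e]
    exact h G s hG hs'

end PiKernel

/-! ### The mutation kernel and one step of the algorithm -/

section Move

variable {N C : ℕ} (π₀ : Measure S) [IsProbabilityMeasure π₀] (k : Kernel S S) [IsMarkovKernel k]

/-- The mixture of the laws `k (x j)` with weights proportional to `u j`, as a kernel in `(u, x)`;
where all the weights vanish it is set to `π₀`. -/
def moveKernel : Kernel ((Fin N → ℝ) × (Fin N → S)) S where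
  toFun p := if ∑ j, ENNReal.ofReal (p.1 j) = 0 then π₀
    else (∑ j, ENNReal.ofReal (p.1 j))⁻¹ • ∑ j, ENNReal.ofReal (p.1 j) • k (p.2 j)
  measurable' := by
    have h1 : Measurable fun p : (Fin N → ℝ) × (Fin N → S) => ∑ j, ENNReal.ofReal (p.1 j) := by
      fun_prop
    refine Measurable.ite (h1 (measurableSet_singleton 0)) measurable_const
      (Measure.measurable_of_measurable_coe _ fun B hB => ?_)
    simp only [Measure.smul_apply, Measure.finsetSum_apply, smul_eq_mul]
    refine h1.inv.mul (Finset.measurable_fun_sum _ fun j _ => ?_)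
    refine Measurable.mul (by fun_prop) ((Kernel.measurable_coe k hB).comp (by fun_prop))

omit [IsProbabilityMeasure π₀] [IsMarkovKernel k] in
lemma moveKernel_apply (p : (Fin N → ℝ) × (Fin N → S)) :
    moveKernel π₀ k p = if ∑ j, ENNReal.ofReal (p.1 j) = 0 then π₀
      else (∑ j, ENNReal.ofReal (p.1 j))⁻¹ • ∑ j, ENNReal.ofReal (p.1 j) • k (p.2 j) := rfl

instance : IsMarkovKernel (moveKernel (N := N) π₀ k) := by
  refine ⟨fun p => ?_⟩
  rw [moveKernel_apply]
  split_ifs with h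
  · infer_instance
  · refine ⟨?_⟩
    simp only [Measure.smul_apply, Measure.finsetSum_apply, smul_eq_mul, measure_univ, mul_one]
    exact ENNReal.inv_mul_cancel h (by simp)

omit [IsProbabilityMeasure π₀] [IsMarkovKernel k] in
lemma moveKernel_apply_of_pos {u : Fin N → ℝ} (hu : ∀ j, 0 ≤ u j) (hs : 0 < ∑ j, u j)
    (x : Fin N → S) : moveKernel π₀ k (u, x)
      = ENNReal.ofReal (1 / ∑ j, u j) • ∑ j, ENNReal.ofReal (u j) • k (x j) := by
  have e : ∑ j, ENNReal.ofReal (u j) = ENNReal.ofReal (∑ j, u j) :=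
    (ENNReal.ofReal_sum_of_nonneg fun j _ => hu j).symm
  rw [moveKernel_apply, if_neg]
  · simp only [e]
    rw [one_div, ENNReal.ofReal_inv_of_pos hs]
  · simp only [e]
    simpa using hs

omit [IsProbabilityMeasure π₀] in
lemma integral_moveKernel {u : Fin N → ℝ} (hu : ∀ j, 0 ≤ u j) (hs : 0 < ∑ j, u j)
    (x : Fin N → S) {φ : S → ℝ} (hφ : IsTestFunction φ) :
    ∫ y, φ y ∂moveKernel π₀ k (u, x) = 1 / (∑ j, u j) * ∑ j, u j * ∫ y, φ y ∂k (x j) := by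
  rw [moveKernel_apply_of_pos π₀ k hu hs, integral_smul_measure,
    ENNReal.toReal_ofReal (by positivity), integral_finsetSum_measure, smul_eq_mul]
  · congr 1
    refine Finset.sum_congr rfl fun j _ => ?_
    rw [integral_smul_measure, ENNReal.toReal_ofReal (hu j), smul_eq_mul]
  · intro j _
    exact (hφ.integrable _).smul_measure ENNReal.ofReal_ne_top

omit [IsProbabilityMeasure π₀] in
lemma moveKernel_real_of_pos {u : Fin N → ℝ} (hu : ∀ j, 0 ≤ u j) (hs : 0 < ∑ j, u j)
    (x : Fin N → S) {B : Set S} (hB : MeasurableSet B) :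
    (moveKernel π₀ k (u, x)).real B = 1 / (∑ j, u j) * ∑ j, u j * (k (x j)).real B := by
  have h := integral_moveKernel π₀ k hu hs x (φ := B.indicator 1)
    ⟨measurable_one.indicator hB, 1, fun y => by
      by_cases hy : y ∈ B <;> simp [hy]⟩
  simpa [integral_indicator_one hB] using h

/-- Multiply the weights of a weighted sample by the entries of a row. -/
def reweight (p : ((Fin N → ℝ) × (Fin N → S)) × (Fin N → ℝ)) : (Fin N → ℝ) × (Fin N → S) :=
  (fun j => p.2 j * p.1.1 j, p.1.2)

lemma measurable_reweight : Measurable (reweight (S := S) (N := N)) := by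
  unfold reweight
  fun_prop

/-- The joint law of a row of the connectivity matrix and of the particle moved according to it,
given the weighted sample. -/
def rowMove (C : ℕ) : Kernel ((Fin N → ℝ) × (Fin N → S)) ((Fin N → ℝ) × S) :=
  Kernel.const _ (uniformOn (connRows N C)) ⊗ₖ (moveKernel π₀ k).comap reweight measurable_reweight

lemma isMarkovKernel_rowMove (hCN : C ≤ N) : IsMarkovKernel (rowMove (N := N) π₀ k C) := by
  have := isProbabilityMeasure_uniformOn_connRows hCN
  unfold rowMove
  infer_instance

lemma integral_rowMove {F : Type*} [NormedAddCommGroup F] [NormedSpace ℝ F] (hCN : C ≤ N)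
    (y : (Fin N → ℝ) × (Fin N → S)) {f : (Fin N → ℝ) × S → F} (hf : StronglyMeasurable f) {M : ℝ}
    (hM : ∀ z, ‖f z‖ ≤ M) :
    ∫ z, f z ∂rowMove π₀ k C y
      = ∫ r, ∫ s, f (r, s) ∂moveKernel π₀ k (reweight (y, r)) ∂uniformOn (connRows N C) := by
  have := isProbabilityMeasure_uniformOn_connRows hCN
  have := isMarkovKernel_rowMove π₀ k hCN
  unfold rowMove at *
  rw [integral_compProd]
  · rfl
  · exact Integrable.of_bound hf.aestronglyMeasurable M (ae_of_all _ hM)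

/-- If the matrix has independent uniform rows and is independent of the weighted sample, and if
the particles are moved independently according to the rows of the matrix, then the pairs
(row, new particle) are conditionally i.i.d. given the weighted sample. -/
theorem condIID_of_move (hCN : C ≤ N) {Ω : Type*} [MeasurableSpace Ω] {P : Measure Ω}
    [IsProbabilityMeasure P] {Y : Ω → (Fin N → ℝ) × (Fin N → S)} {A : Ω → Fin N → Fin N → ℝ}
    {X : Ω → Fin N → S} (hY : Measurable Y) (hA : Measurable A) (hX : Measurable X)
    (hlaw : P.map A = connLaw N C) (hind : IndepFun Y A P)
    (hmove : ∀ (G : Set (((Fin N → ℝ) × (Fin N → S)) × (Fin N → Fin N → ℝ))) (s : Fin N → Set S),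
      MeasurableSet G → (∀ i, MeasurableSet (s i)) →
      P ({ω | (Y ω, A ω) ∈ G} ∩ {ω | ∀ i, X ω i ∈ s i})
        = ∫⁻ ω in {ω | (Y ω, A ω) ∈ G}, ∏ i, moveKernel π₀ k (reweight (Y ω, A ω i)) (s i) ∂P) :
    CondIID P Y (fun ω i => (A ω i, X ω i)) (rowMove π₀ k C) := by
  intro H f M hH hHM hf hfM
  have := isProbabilityMeasure_uniformOn_connRows hCN
  have : IsProbabilityMeasure (connLaw N C) := by unfold connLaw; infer_instance
  have := Measure.isProbabilityMeasure_map (μ := P) hY.aemeasurable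
  have hYA : Measurable fun ω => (Y ω, A ω) := hY.prodMk hA
  have := Measure.isProbabilityMeasure_map (μ := P) hYA.aemeasurable
  set κ : Fin N → Kernel (((Fin N → ℝ) × (Fin N → S)) × (Fin N → Fin N → ℝ)) S := fun i =>
    (moveKernel π₀ k).comap (fun p => reweight (p.1, p.2 i)) (measurable_reweight.comp (by fun_prop))
    with hκ
  have hjoint := map_prod_eq_compProd_piKernel (P := P) κ hYA hX hmove
  set G : (((Fin N → ℝ) × (Fin N → S)) × (Fin N → Fin N → ℝ)) × (Fin N → S) → ℂ :=
    fun p => H p.1.1 * ∏ i, f i (p.1.1, (p.1.2 i, p.2 i)) with hG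
  have hGm : Measurable G := by
    refine (hH.comp (by fun_prop)).mul (Finset.measurable_fun_prod _ fun i _ =>
      (hf i).comp (by fun_prop))
  have hGb : ∀ p, ‖G p‖ ≤ M * M ^ N := fun p => by
    simp only [hG, norm_mul, norm_prod]
    refine mul_le_mul (hHM _) ?_ (Finset.prod_nonneg fun _ _ => norm_nonneg _)
      ((norm_nonneg _).trans (hHM p.1.1))
    refine (Finset.prod_le_prod (fun _ _ => norm_nonneg _) fun i _ => hfM i _).trans (by simp)
  set h : Fin N → ((Fin N → ℝ) × (Fin N → S)) × (Fin N → ℝ) → ℂ := fun i p =>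
    ∫ s, f i (p.1, (p.2, s)) ∂moveKernel π₀ k (reweight p) with hh
  have hhm : ∀ i, StronglyMeasurable (h i) := fun i => by
    have : Measurable fun q : (((Fin N → ℝ) × (Fin N → S)) × (Fin N → ℝ)) × S =>
        f i (q.1.1, (q.1.2, q.2)) := (hf i).comp (by fun_prop)
    exact this.stronglyMeasurable.integral_kernel_prod_right'
      (κ := (moveKernel π₀ k).comap reweight measurable_reweight)
  have hhb : ∀ i p, ‖h i p‖ ≤ M := fun i p => by
    refine (norm_integral_le_of_norm_le_const (ae_of_all _ fun s => hfM i _)).trans (by simp)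
  -- Given the sample and the matrix, particle i depends on the matrix only through row i, so
  -- integrating out the particles leaves a product with one row per factor.
  have hin : ∀ p, ∫ x, G (p, x) ∂piKernel κ p = H p.1 * ∏ i, h i (p.1, p.2 i) := fun p => by
    simp only [hG]
    rw [integral_const_mul, piKernel_apply,
      integral_fintype_prod_eq_prod (fun i s => f i (p.1, (p.2 i, s)))]
    rfl
  -- The rows are independent, hence integrating out the matrix factorises again, into integrals
  -- against `rowMove`.
  have hmid : ∀ y, ∫ a, H y * ∏ i, h i (y, a i) ∂connLaw N C
      = H y * ∏ i, ∫ z, f i (y, z) ∂rowMove π₀ k C y := fun y => by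
    rw [integral_const_mul, connLaw, integral_fintype_prod_eq_prod (fun i r => h i (y, r))]
    congr 1
    refine Finset.prod_congr rfl fun i _ => ?_
    rw [integral_rowMove π₀ k hCN y (f := fun z => f i (y, z)) (M := M)
      ((hf i).comp (by fun_prop)).stronglyMeasurable (fun z => hfM i _)]
  have hm1 : Measurable fun p : ((Fin N → ℝ) × (Fin N → S)) × (Fin N → Fin N → ℝ) =>
      H p.1 * ∏ i, h i (p.1, p.2 i) := by
    refine (hH.comp (by fun_prop)).mul (Finset.measurable_fun_prod _ fun i _ =>
      (hhm i).measurable.comp (by fun_prop))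
  calc ∫ ω, H (Y ω) * ∏ i, f i (Y ω, (A ω i, X ω i)) ∂P
      = ∫ p, G p ∂(P.map fun ω => ((Y ω, A ω), X ω)) := by
        rw [integral_map (hYA.prodMk hX).aemeasurable hGm.aestronglyMeasurable]
    _ = ∫ p, H p.1 * ∏ i, h i (p.1, p.2 i) ∂(P.map fun ω => (Y ω, A ω)) := by
        rw [hjoint, Measure.integral_compProd
          (Integrable.of_bound hGm.aestronglyMeasurable _ (ae_of_all _ hGb))]
        simp_rw [hin]
    _ = ∫ y, ∫ a, H y * ∏ i, h i (y, a i) ∂connLaw N C ∂(P.map Y) := by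
        rw [(indepFun_iff_map_prod_eq_prod_map_map hY.aemeasurable hA.aemeasurable).1 hind, hlaw,
          integral_prod]
        refine Integrable.of_bound hm1.aestronglyMeasurable (M * M ^ N) (ae_of_all _ fun p => ?_)
        simp only [norm_mul, norm_prod]
        refine mul_le_mul (hHM _) ?_ (Finset.prod_nonneg fun _ _ => norm_nonneg _)
          ((norm_nonneg _).trans (hHM p.1))
        refine (Finset.prod_le_prod (fun _ _ => norm_nonneg _) fun i _ => hhb i _).trans (by simp)
    _ = ∫ ω, ∫ a, H (Y ω) * ∏ i, h i (Y ω, a i) ∂connLaw N C ∂P := by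
        rw [integral_map hY.aemeasurable]
        exact hm1.stronglyMeasurable.integral_prod_right'.aestronglyMeasurable
    _ = _ := by simp_rw [hmid]

end Move

/-! ### Runs of the algorithm -/

/-- Each row forms a convex combination, so averaging cannot exceed the largest W_t^j g_t(X_t^j),
and each step costs one factor κ. Positivity keeps every denominator of the algorithm nonzero. -/
lemma weight_pos_le {N C : ℕ} (hC : 1 ≤ C) {g : ℕ → S → ℝ} {κ : ℝ} (hg : IsPotential g κ)
    {x : ℕ → Fin N → S} {a : ℕ → Fin N → Fin N → ℝ} (ha : ∀ t i, a t i ∈ connRows N C) (t : ℕ)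
    (i : Fin N) : 0 < weight g x a t i ∧ weight g x a t i ≤ κ ^ t := by
  induction t generalizing i with
  | zero => simp [weight]
  | succ t ih =>
    have e : weight g x a (t + 1) i = ∑ j, a t i j * (weight g x a t j * g t (x t j)) := by
      simp only [weight, mul_assoc]
    have hp : ∀ j, 0 < weight g x a t j * g t (x t j) := fun j => mul_pos (ih j).1 (hg.pos _ _)
    have hl : ∀ j, weight g x a t j * g t (x t j) ≤ κ ^ (t + 1) := fun j => by
      rw [pow_succ]
      exact mul_le_mul (ih j).2 (hg.le _ _) (hg.pos _ _).le ((ih j).1.le.trans (ih j).2)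
    rw [e]
    exact ⟨connRows.weighted_sum_pos hC (ha t i) hp, connRows.weighted_sum_le hC (ha t i) hl⟩

/-- The particles of time `t`, weighted by `W_t^j g_t(x_t^j)`. -/
def weightedSample {N : ℕ} (g : ℕ → S → ℝ) (x : ℕ → Fin N → S) (a : ℕ → Fin N → Fin N → ℝ)
    (t : ℕ) : (Fin N → ℝ) × (Fin N → S) :=
  (fun j => weight g x a t j * g t (x t j), x t)

/-- The particle approximation of the second-moment measure. -/
def secondHat {N : ℕ} (g : ℕ → S → ℝ) (x : ℕ → Fin N → S) (a : ℕ → Fin N → Fin N → ℝ)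
    (t : ℕ) (φ : S → ℝ) : ℝ :=
  (1 / (N : ℝ)) * ∑ i, weight g x a t i ^ 2 * φ (x t i)

namespace IsRun

variable {Ω : Type*} [MeasurableSpace Ω] {N C : ℕ} {P : Measure Ω} {π₀ : Measure S}
  {K : ℕ → Kernel S S} {g : ℕ → S → ℝ} {κ : ℝ}
  {X : ℕ → Ω → Fin N → S} {α : ℕ → Ω → Fin N → Fin N → ℝ}

lemma sigmaBefore_le (h : IsRun P π₀ K g C X α) (t : ℕ) :
    sigmaBefore X α t ≤ (inferInstance : MeasurableSpace Ω) :=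
  sup_le (iSup₂_le fun s _ => (h.measurable_particles s).comap_le)
    (iSup₂_le fun s _ => (h.measurable_matrix s).comap_le)

lemma sigmaUpTo_le (h : IsRun P π₀ K g C X α) (t : ℕ) :
    sigmaUpTo X α t ≤ (inferInstance : MeasurableSpace Ω) :=
  sup_le (iSup₂_le fun s _ => (h.measurable_particles s).comap_le)
    (iSup₂_le fun s _ => (h.measurable_matrix s).comap_le)

end IsRun

/-! ### Measurability of weights and particles with respect to the past. -/

section Sigma

variable {Ω : Type*} {N : ℕ} (X : ℕ → Ω → Fin N → S) (α : ℕ → Ω → Fin N → Fin N → ℝ)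

lemma sigmaBefore_le_sigmaUpTo (t : ℕ) : sigmaBefore X α t ≤ sigmaUpTo X α t :=
  sup_le_sup le_rfl (iSup₂_le fun s hs => le_iSup₂_of_le s hs.le le_rfl)

lemma sigmaUpTo_le_sigmaBefore_succ (t : ℕ) : sigmaUpTo X α t ≤ sigmaBefore X α (t + 1) :=
  sup_le_sup (iSup₂_le fun s hs => le_iSup₂_of_le s (hs.trans t.le_succ) le_rfl)
    (iSup₂_le fun s hs => le_iSup₂_of_le s (Nat.lt_succ_of_le hs) le_rfl)

lemma measurable_particles_sigmaBefore (t : ℕ) : Measurable[sigmaBefore X α t] (X t) :=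
  Measurable.of_comap_le (le_sup_of_le_left (le_iSup₂_of_le t le_rfl le_rfl))

lemma measurable_matrix_sigmaUpTo (t : ℕ) : Measurable[sigmaUpTo X α t] (α t) :=
  Measurable.of_comap_le (le_sup_of_le_right (le_iSup₂_of_le t le_rfl le_rfl))

/-- W_t involves the matrices only up to time t - 1. It therefore precedes α_t, which is what makes
α_t independent of the weighted sample of time t. -/
lemma measurable_weight_sigmaBefore {g : ℕ → S → ℝ} (hg : ∀ t, Measurable (g t)) (t : ℕ)
    (i : Fin N) :
    Measurable[sigmaBefore X α t] fun ω => weight g (fun s => X s ω) (fun s => α s ω) t i := by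
  induction t generalizing i with
  | zero => exact measurable_const
  | succ t ih =>
    have h1 := sigmaUpTo_le_sigmaBefore_succ X α t
    have h2 := (sigmaBefore_le_sigmaUpTo X α t).trans h1
    have hX : Measurable[sigmaBefore X α (t + 1)] (X t) :=
      (measurable_particles_sigmaBefore X α t).mono h2 le_rfl
    have hα : Measurable[sigmaBefore X α (t + 1)] (α t) :=
      (measurable_matrix_sigmaUpTo X α t).mono h1 le_rfl
    simp only [weight]
    refine Finset.measurable_fun_sum _ fun j _ => Measurable.mul (Measurable.mul ?_ ?_) ?_
    · exact (measurable_pi_apply j).comp ((measurable_pi_apply i).comp hα)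
    · exact (ih j).mono h2 le_rfl
    · exact (hg t).comp ((measurable_pi_apply j).comp hX)

lemma measurable_weightedSample_sigmaBefore {g : ℕ → S → ℝ} (hg : ∀ t, Measurable (g t)) (t : ℕ) :
    Measurable[sigmaBefore X α t]
      fun ω => weightedSample g (fun s => X s ω) (fun s => α s ω) t := by
  have hX := measurable_particles_sigmaBefore X α t
  let _ : MeasurableSpace Ω := sigmaBefore X α t
  refine Measurable.prodMk (measurable_pi_lambda _ fun j => Measurable.mul ?_ ?_) hX
  · exact measurable_weight_sigmaBefore X α hg t j
  · exact (hg t).comp ((measurable_pi_apply j).comp hX)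

end Sigma

/-! ### Almost sure bounds and conditional independence along a run. -/

namespace IsRun

variable {Ω : Type*} [MeasurableSpace Ω] {N C : ℕ} {P : Measure Ω} [IsProbabilityMeasure P]
  {π₀ : Measure S} [IsProbabilityMeasure π₀]
  {K : ℕ → Kernel S S} [∀ t, IsMarkovKernel (K t)] {g : ℕ → S → ℝ} {κ : ℝ}
  {X : ℕ → Ω → Fin N → S} {α : ℕ → Ω → Fin N → Fin N → ℝ}

omit [IsProbabilityMeasure P] [IsProbabilityMeasure π₀] [∀ t, IsMarkovKernel (K t)] in
lemma measurable_weight (h : IsRun P π₀ K g C X α) (hg : ∀ t, Measurable (g t)) (t : ℕ)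
    (i : Fin N) : Measurable fun ω => weight g (fun s => X s ω) (fun s => α s ω) t i :=
  (measurable_weight_sigmaBefore X α hg t i).mono (h.sigmaBefore_le t) le_rfl

omit [IsProbabilityMeasure P] [IsProbabilityMeasure π₀] [∀ t, IsMarkovKernel (K t)] in
lemma measurable_particle (h : IsRun P π₀ K g C X α) (t : ℕ) (i : Fin N) :
    Measurable fun ω => X t ω i :=
  (measurable_pi_apply i).comp (h.measurable_particles t)

omit [IsProbabilityMeasure P] [IsProbabilityMeasure π₀] [∀ t, IsMarkovKernel (K t)] in
lemma measurable_weightedSample (h : IsRun P π₀ K g C X α) (hg : ∀ t, Measurable (g t)) (t : ℕ) :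
    Measurable fun ω => weightedSample g (fun s => X s ω) (fun s => α s ω) t :=
  (measurable_weightedSample_sigmaBefore X α hg t).mono (h.sigmaBefore_le t) le_rfl

omit [IsProbabilityMeasure P] [IsProbabilityMeasure π₀] [∀ t, IsMarkovKernel (K t)] in
lemma measurable_gammaHat (h : IsRun P π₀ K g C X α) (hg : ∀ t, Measurable (g t)) (t : ℕ)
    {φ : S → ℝ} (hφ : Measurable φ) :
    Measurable fun ω => gammaHat g (fun s => X s ω) (fun s => α s ω) t φ :=
  (Finset.measurable_fun_sum _ fun i _ =>
    (h.measurable_weight hg t i).mul (hφ.comp (h.measurable_particle t i))).const_mul _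

omit [IsProbabilityMeasure P] [IsProbabilityMeasure π₀] [∀ t, IsMarkovKernel (K t)] in
lemma measurable_secondHat (h : IsRun P π₀ K g C X α) (hg : ∀ t, Measurable (g t)) (t : ℕ)
    {φ : S → ℝ} (hφ : Measurable φ) :
    Measurable fun ω => secondHat g (fun s => X s ω) (fun s => α s ω) t φ :=
  (Finset.measurable_fun_sum _ fun i _ =>
    ((h.measurable_weight hg t i).pow_const 2).mul
      (hφ.comp (h.measurable_particle t i))).const_mul _

omit [IsProbabilityMeasure P] [IsProbabilityMeasure π₀] [∀ t, IsMarkovKernel (K t)] in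
lemma measurable_piHat (h : IsRun P π₀ K g C X α) (hg : ∀ t, Measurable (g t)) (t : ℕ)
    {φ : S → ℝ} (hφ : Measurable φ) :
    Measurable fun ω => piHat g (fun s => X s ω) (fun s => α s ω) t φ :=
  Finset.measurable_fun_sum _ fun i _ =>
    ((h.measurable_weight hg t i).div
      (Finset.measurable_fun_sum _ fun k _ => h.measurable_weight hg t k)).mul
      (hφ.comp (h.measurable_particle t i))

omit [IsProbabilityMeasure P] [IsProbabilityMeasure π₀] [∀ t, IsMarkovKernel (K t)] in
lemma ae_rows (h : IsRun P π₀ K g C X α) (hCN : C ≤ N) :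
    ∀ᵐ ω ∂P, ∀ t i, α t ω i ∈ connRows N C := by
  have := isProbabilityMeasure_uniformOn_connRows hCN
  rw [ae_all_iff]
  intro t
  have h1 : ∀ᵐ a ∂connLaw N C, ∀ i, a i ∈ connRows N C := by
    rw [ae_all_iff]
    intro i
    exact (Measure.quasiMeasurePreserving_eval (fun _ : Fin N => uniformOn (connRows N C)) i).ae
      (ae_mem_connRows N C)
  rw [← h.law_matrix t] at h1
  exact ae_of_ae_map (h.measurable_matrix t).aemeasurable h1

omit [IsProbabilityMeasure P] [IsProbabilityMeasure π₀] [∀ t, IsMarkovKernel (K t)] in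
lemma ae_weight (h : IsRun P π₀ K g C X α) (hg : IsPotential g κ) (hC : 1 ≤ C) (hCN : C ≤ N) :
    ∀ᵐ ω ∂P, ∀ t i, 0 < weight g (fun s => X s ω) (fun s => α s ω) t i
      ∧ weight g (fun s => X s ω) (fun s => α s ω) t i ≤ κ ^ t := by
  filter_upwards [h.ae_rows hCN] with ω hω
  exact fun t i => weight_pos_le hC hg hω t i

omit [IsProbabilityMeasure P] [∀ t, IsMarkovKernel (K t)] in
-- The initial sample fits the same scheme with a trivial conditioning variable.
lemma condIID_zero (h : IsRun P π₀ K g C X α) :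
    CondIID P (fun _ => ()) (X 0) (Kernel.const Unit π₀) := by
  intro H f M _ _ hf _
  simp only [Kernel.const_apply]
  rw [integral_const_mul]
  have e : ∫ ω, ∏ i, f i ((), X 0 ω i) ∂P = ∫ x, ∏ i, f i ((), x i) ∂(P.map (X 0)) := by
    rw [integral_map (h.measurable_particles 0).aemeasurable]
    exact (Finset.measurable_fun_prod _ fun i _ =>
      (hf i).comp (by fun_prop)).aestronglyMeasurable
  have hP : IsProbabilityMeasure (P.map (X 0)) := by rw [h.law_init]; infer_instance
  have hP' : IsProbabilityMeasure P := Measure.isProbabilityMeasure_of_map (X 0)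
  rw [e, h.law_init, integral_fintype_prod_eq_prod (fun i s => f i ((), s))]
  simp

/-- The conditional expectation in `law_move` is integrated over events depending on the weighted
sample and α_t, giving the disintegration required by `condIID_of_move`. -/
theorem condIID_succ (h : IsRun P π₀ K g C X α) (hg : IsPotential g κ) (hC : 1 ≤ C) (hCN : C ≤ N)
    (t : ℕ) :
    CondIID P (fun ω => weightedSample g (fun s => X s ω) (fun s => α s ω) t)
      (fun ω i => (α t ω i, X (t + 1) ω i)) (rowMove π₀ (K (t + 1)) C) := by
  have hY := measurable_weightedSample_sigmaBefore X α hg.measurable t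
  refine condIID_of_move π₀ (K (t + 1)) hCN (h.measurable_weightedSample hg.measurable t)
    (h.measurable_matrix t) (h.measurable_particles _) (h.law_matrix t) ?_ ?_
  · rw [IndepFun_iff_Indep]
    exact (indep_of_indep_of_le_right (h.indep_matrix t) hY.comap_le).symm
  · intro G s hG hs
    have hle := h.sigmaUpTo_le t
    set Γ := {ω | (weightedSample g (fun s => X s ω) (fun s => α s ω) t, α t ω) ∈ G} with hΓ
    have hΓm : MeasurableSet[sigmaUpTo X α t] Γ :=
      ((hY.mono (sigmaBefore_le_sigmaUpTo X α t) le_rfl).prodMk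
        (measurable_matrix_sigmaUpTo X α t)) hG
    set D := {ω | ∀ i, X (t + 1) ω i ∈ s i} with hD
    have hDm : MeasurableSet D := by
      have : D = X (t + 1) ⁻¹' (Set.univ.pi s) := by ext; simp [hD]
      rw [this]
      exact h.measurable_particles _ (MeasurableSet.univ_pi hs)
    have hΓm' : MeasurableSet Γ := hle _ hΓm
    -- Γ belongs to the conditioning σ-algebra, so P(Γ ∩ D) is the integral over Γ of the
    -- conditional probability of D.
    have h1 := setIntegral_condExp (μ := P) hle
      (f := D.indicator fun _ => (1 : ℝ)) ((integrable_const _).indicator hDm) hΓm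
    have h2 : ∫ ω in Γ, D.indicator (fun _ => (1 : ℝ)) ω ∂P = P.real (Γ ∩ D) := by
      rw [integral_indicator_const _ hDm, measureReal_restrict_apply hDm, Set.inter_comm]
      simp
    -- Almost surely the rows are admissible and the weights positive, so the default value π₀ in
    -- `moveKernel` never occurs and the kernel agrees with `moveProb`.
    have h3 : ∀ᵐ ω ∂P, (P⟦D | sigmaUpTo X α t⟧) ω
        = (∏ i, moveKernel π₀ (K (t + 1)) (reweight
          (weightedSample g (fun s => X s ω) (fun s => α s ω) t, α t ω i)) (s i)).toReal := by
      filter_upwards [h.law_move t s hs, h.ae_rows hCN, h.ae_weight hg hC hCN] with ω h4 h5 h6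
      rw [h4, ENNReal.toReal_prod]
      refine Finset.prod_congr rfl fun i _ => ?_
      have hv : ∀ j, 0 < weight g (fun s => X s ω) (fun s => α s ω) t j * g t (X t ω j) := fun j =>
        mul_pos (h6 t j).1 (hg.pos _ _)
      have := moveKernel_real_of_pos π₀ (K (t + 1))
        (u := fun j => α t ω i j * (weight g (fun s => X s ω) (fun s => α s ω) t j * g t (X t ω j)))
        (fun j => mul_nonneg (connRows.nonneg (h5 t i) j) (hv j).le)
        (connRows.weighted_sum_pos hC (h5 t i) hv) (X t ω) (hs i)
      simp only [moveProb, weight, mul_assoc] at this ⊢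
      exact this.symm
    have h7 : P.real (Γ ∩ D) = ∫ ω in Γ, (∏ i, moveKernel π₀ (K (t + 1)) (reweight
        (weightedSample g (fun s => X s ω) (fun s => α s ω) t, α t ω i)) (s i)).toReal ∂P := by
      rw [← h2, ← h1]
      exact integral_congr_ae (ae_restrict_of_ae h3)
    have hm : Measurable fun ω => ∏ i, moveKernel π₀ (K (t + 1)) (reweight
        (weightedSample g (fun s => X s ω) (fun s => α s ω) t, α t ω i)) (s i) :=
      Finset.measurable_fun_prod _ fun i _ => (Kernel.measurable_coe _ (hs i)).comp
        (measurable_reweight.comp ((h.measurable_weightedSample hg.measurable t).prodMk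
          ((measurable_pi_apply i).comp (h.measurable_matrix t))))
    have hl1 : ∀ ω, ∏ i, moveKernel π₀ (K (t + 1)) (reweight
        (weightedSample g (fun s => X s ω) (fun s => α s ω) t, α t ω i)) (s i) ≤ 1 := fun ω =>
      Finset.prod_le_one' fun i _ => prob_le_one
    rw [integral_toReal hm.aemeasurable
      (ae_of_all _ fun ω => (hl1 ω).trans_lt ENNReal.one_lt_top)] at h7
    refine (ENNReal.toReal_eq_toReal_iff' (measure_ne_top _ _) (ne_of_lt ?_)).1 h7
    refine lt_of_le_of_lt (lintegral_mono hl1) ?_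
    simp

end IsRun

/-! ### Conditional moments of the new particles -/

/-- `(∑ j, r_j v_j)^k φ(s)`, as a function of the weighted sample `(v, x)` and of the pair `(r, s)`,
with the weight truncated to `[0, b]`. -/
def clampedMoment {N : ℕ} (b : ℝ) (k : ℕ) (φ : S → ℝ)
    (p : ((Fin N → ℝ) × (Fin N → S)) × ((Fin N → ℝ) × S)) : ℝ :=
  max 0 (min b (∑ j, p.2.1 j * p.1.1 j)) ^ k * φ p.2.2

section Moments

variable {N C : ℕ} {b : ℝ} {φ : S → ℝ}

lemma measurable_clampedMoment (hφ : Measurable φ) (k : ℕ) :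
    Measurable (clampedMoment (N := N) b k φ) := by
  unfold clampedMoment
  fun_prop

omit [MeasurableSpace S] in
lemma abs_clampedMoment_le (hb : 0 ≤ b) {M : ℝ} (hM : ∀ x, |φ x| ≤ M) (k : ℕ)
    (p : ((Fin N → ℝ) × (Fin N → S)) × ((Fin N → ℝ) × S)) : |clampedMoment b k φ p| ≤ b ^ k * M := by
  have h0 : 0 ≤ max 0 (min b (∑ j, p.2.1 j * p.1.1 j)) := le_max_left _ _
  have h1 : max 0 (min b (∑ j, p.2.1 j * p.1.1 j)) ≤ b := max_le hb (min_le_left _ _)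
  rw [clampedMoment, abs_mul, abs_of_nonneg (pow_nonneg h0 k)]
  exact mul_le_mul (pow_le_pow_left₀ h0 h1 k) (hM _) (abs_nonneg _) (pow_nonneg hb k)

omit [MeasurableSpace S] in
lemma clampedMoment_of_mem {y : (Fin N → ℝ) × (Fin N → S)} {r : Fin N → ℝ}
    (h0 : 0 ≤ ∑ j, r j * y.1 j) (h1 : ∑ j, r j * y.1 j ≤ b) (k : ℕ) (s : S) :
    clampedMoment b k φ (y, (r, s)) = (∑ j, r j * y.1 j) ^ k * φ s := by
  simp only [clampedMoment]
  rw [min_eq_right h1, max_eq_right h0]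

/-- The moved particle has the new weight as the denominator of its law, and one of the k + 1 powers
of that weight cancels it. What remains is a polynomial in the row. -/
lemma integral_rowMove_clampedMoment (π₀ : Measure S) [IsProbabilityMeasure π₀] (κ : Kernel S S)
    [IsMarkovKernel κ] (hC : 1 ≤ C) (hCN : C ≤ N) (hb : 0 ≤ b) (hφ : IsTestFunction φ)
    {y : (Fin N → ℝ) × (Fin N → S)} (hy : ∀ j, 0 < y.1 j ∧ y.1 j ≤ b) (k : ℕ) :
    ∫ z, clampedMoment b (k + 1) φ (y, z) ∂rowMove π₀ κ C y
      = ∫ r, (∑ j, r j * y.1 j) ^ k * ∑ j, r j * (y.1 j * ∫ s, φ s ∂κ (y.2 j))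
          ∂uniformOn (connRows N C) := by
  obtain ⟨M, -, hM⟩ := hφ.exists_pos_bound
  have hm := measurable_clampedMoment (N := N) (b := b) hφ.1 (k + 1)
  rw [integral_rowMove π₀ κ hCN y (f := fun z => clampedMoment b (k + 1) φ (y, z))
    (hm.comp (by fun_prop)).stronglyMeasurable
    (fun z => abs_clampedMoment_le hb hM (k + 1) (y, z))]
  refine integral_congr_ae ?_
  filter_upwards [ae_mem_connRows N C] with r hr
  have h0 := connRows.weighted_sum_pos hC hr fun j => (hy j).1
  have h1 := connRows.weighted_sum_le hC hr fun j => (hy j).2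
  simp_rw [clampedMoment_of_mem h0.le h1]
  rw [integral_const_mul, reweight, integral_moveKernel π₀ κ
    (fun j => mul_nonneg (connRows.nonneg hr j) (hy j).1.le) h0 _ hφ, pow_succ]
  simp only [mul_assoc]
  congr 1
  rw [← mul_assoc, mul_one_div_cancel h0.ne', one_mul]

end Moments

/-! ### Conditional moments and mean square deviations along a run. -/

namespace IsRun

variable {Ω : Type*} [MeasurableSpace Ω] {N C : ℕ} {P : Measure Ω} [IsProbabilityMeasure P]
  {π₀ : Measure S} [IsProbabilityMeasure π₀]
  {K : ℕ → Kernel S S} [∀ t, IsMarkovKernel (K t)] {g : ℕ → S → ℝ} {κ : ℝ}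
  {X : ℕ → Ω → Fin N → S} {α : ℕ → Ω → Fin N → Fin N → ℝ} {φ : S → ℝ}

omit [IsProbabilityMeasure P] [IsProbabilityMeasure π₀] [∀ t, IsMarkovKernel (K t)] in
lemma ae_weightedSample (h : IsRun P π₀ K g C X α) (hg : IsPotential g κ) (hC : 1 ≤ C)
    (hCN : C ≤ N) (t : ℕ) :
    ∀ᵐ ω ∂P, ∀ j, 0 < (weightedSample g (fun s => X s ω) (fun s => α s ω) t).1 j
      ∧ (weightedSample g (fun s => X s ω) (fun s => α s ω) t).1 j ≤ κ ^ (t + 1) := by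
  filter_upwards [h.ae_weight hg hC hCN] with ω hω j
  refine ⟨mul_pos (hω t j).1 (hg.pos _ _), ?_⟩
  rw [pow_succ]
  exact mul_le_mul (hω t j).2 (hg.le _ _) (hg.pos _ _).le ((hω t j).1.le.trans (hω t j).2)

omit [IsProbabilityMeasure P] [IsProbabilityMeasure π₀] [∀ t, IsMarkovKernel (K t)] in
-- The truncation only makes the function bounded everywhere, as `CondIID` requires; along a run the
-- weights lie almost surely in (0, κ^(t+1)], so it is inactive.
lemma ae_clampedMoment (h : IsRun P π₀ K g C X α) (hg : IsPotential g κ) (hC : 1 ≤ C)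
    (hCN : C ≤ N) (t k : ℕ) :
    ∀ᵐ ω ∂P, ∀ i, clampedMoment (κ ^ (t + 1)) k φ
        (weightedSample g (fun s => X s ω) (fun s => α s ω) t, (α t ω i, X (t + 1) ω i))
      = weight g (fun s => X s ω) (fun s => α s ω) (t + 1) i ^ k * φ (X (t + 1) ω i) := by
  filter_upwards [h.ae_weightedSample hg hC hCN t, h.ae_rows hCN] with ω h1 h2 i
  rw [clampedMoment_of_mem
    (connRows.weighted_sum_pos hC (h2 t i) fun j => (h1 j).1).le
    (connRows.weighted_sum_le hC (h2 t i) fun j => (h1 j).2)]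
  simp only [weightedSample, weight, mul_assoc]

omit [IsProbabilityMeasure P] in
-- Conditional unbiasedness, from E r_j = 1/N.
lemma ae_integral_clampedMoment_one (h : IsRun P π₀ K g C X α) (hg : IsPotential g κ) (hC : 1 ≤ C)
    (hCN : C ≤ N) (hκ : 0 ≤ κ) (hφ : IsTestFunction φ) (t : ℕ) :
    ∀ᵐ ω ∂P, ∫ z, clampedMoment (κ ^ (t + 1)) 1 φ
        (weightedSample g (fun s => X s ω) (fun s => α s ω) t, z) ∂rowMove π₀ (K (t + 1)) C
          (weightedSample g (fun s => X s ω) (fun s => α s ω) t)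
      = gammaHat g (fun s => X s ω) (fun s => α s ω) t (Qop K g t φ) := by
  filter_upwards [h.ae_weightedSample hg hC hCN t] with ω h1
  rw [integral_rowMove_clampedMoment π₀ (K (t + 1)) hC hCN (pow_nonneg hκ _) hφ h1 0]
  simp only [pow_zero, one_mul]
  rw [integral_connRows_linear hC hCN]
  simp only [weightedSample, gammaHat, Qop, mul_assoc]

omit [IsProbabilityMeasure P] in
-- An identity for each N. Two slots of the row either choose the same ancestor, giving `secondHat`,
-- or distinct ones, giving a product of two `gammaHat` minus its diagonal.
lemma ae_integral_clampedMoment_two (h : IsRun P π₀ K g C X α) (hg : IsPotential g κ) (hC : 1 ≤ C)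
    (hCN : C ≤ N) (hκ : 0 ≤ κ) (hφ : IsTestFunction φ) (t : ℕ) :
    ∀ᵐ ω ∂P, ∫ z, clampedMoment (κ ^ (t + 1)) 2 φ
        (weightedSample g (fun s => X s ω) (fun s => α s ω) t, z) ∂rowMove π₀ (K (t + 1)) C
          (weightedSample g (fun s => X s ω) (fun s => α s ω) t)
      = 1 / (C : ℝ) * secondHat g (fun s => X s ω) (fun s => α s ω) t (QopSq K g t φ)
        + ((C : ℝ) - 1) / (C * (N * (N - 1)))
          * ((N * gammaHat g (fun s => X s ω) (fun s => α s ω) t (g t))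
              * (N * gammaHat g (fun s => X s ω) (fun s => α s ω) t (Qop K g t φ))
            - N * secondHat g (fun s => X s ω) (fun s => α s ω) t (QopSq K g t φ)) := by
  have hN : (N : ℝ) ≠ 0 := by have : 1 ≤ N := hC.trans hCN; positivity
  filter_upwards [h.ae_weightedSample hg hC hCN t] with ω h1
  rw [integral_rowMove_clampedMoment π₀ (K (t + 1)) hC hCN (pow_nonneg hκ _) hφ h1 1]
  simp only [pow_one]
  rw [integral_connRows_bilinear hC hCN]
  have e1 : ∀ s : ℝ, (N : ℝ) * (1 / N * s) = s := fun s => by field_simp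
  have e2 : ∀ j, weight g (fun s => X s ω) (fun s => α s ω) t j * g t (X t ω j)
      * (weight g (fun s => X s ω) (fun s => α s ω) t j * g t (X t ω j)
        * ∫ s, φ s ∂K (t + 1) (X t ω j))
      = weight g (fun s => X s ω) (fun s => α s ω) t j ^ 2
        * (g t (X t ω j) ^ 2 * ∫ s, φ s ∂K (t + 1) (X t ω j)) := fun j => by ring
  have e3 : ∀ j, weight g (fun s => X s ω) (fun s => α s ω) t j * g t (X t ω j)
        * ∫ s, φ s ∂K (t + 1) (X t ω j)
      = weight g (fun s => X s ω) (fun s => α s ω) t j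
        * (g t (X t ω j) * ∫ s, φ s ∂K (t + 1) (X t ω j)) := fun j => by ring
  simp only [weightedSample, gammaHat, secondHat, Qop, QopSq, e1, e2]
  simp only [e3]

omit [IsProbabilityMeasure P] [IsProbabilityMeasure π₀] [∀ t, IsMarkovKernel (K t)] in
lemma ae_abs_gammaHat_le (h : IsRun P π₀ K g C X α) (hg : IsPotential g κ) (hC : 1 ≤ C)
    (hCN : C ≤ N) {M : ℝ} (hM : ∀ x, |φ x| ≤ M) (t : ℕ) :
    ∀ᵐ ω ∂P, |gammaHat g (fun s => X s ω) (fun s => α s ω) t φ| ≤ κ ^ t * M := by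
  have hN : (0 : ℝ) < N := by have : 1 ≤ N := hC.trans hCN; positivity
  filter_upwards [h.ae_weight hg hC hCN] with ω h1
  rw [gammaHat, abs_mul, abs_of_pos (by positivity : 0 < 1 / (N : ℝ)), one_div_mul_eq_div,
    div_le_iff₀ hN]
  refine (Finset.abs_sum_le_sum_abs _ _).trans ?_
  refine (Finset.sum_le_sum (g := fun _ => κ ^ t * M) fun i _ => ?_).trans ?_
  · rw [abs_mul, abs_of_pos (h1 t i).1]
    exact mul_le_mul (h1 t i).2 (hM _) (abs_nonneg _) ((h1 t i).1.le.trans (h1 t i).2)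
  · simp [mul_comm]

omit [IsProbabilityMeasure P] [IsProbabilityMeasure π₀] [∀ t, IsMarkovKernel (K t)] in
lemma ae_abs_secondHat_le (h : IsRun P π₀ K g C X α) (hg : IsPotential g κ) (hC : 1 ≤ C)
    (hCN : C ≤ N) {M : ℝ} (hM : ∀ x, |φ x| ≤ M) (t : ℕ) :
    ∀ᵐ ω ∂P, |secondHat g (fun s => X s ω) (fun s => α s ω) t φ| ≤ (κ ^ t) ^ 2 * M := by
  have hN : (0 : ℝ) < N := by have : 1 ≤ N := hC.trans hCN; positivity
  filter_upwards [h.ae_weight hg hC hCN] with ω h1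
  rw [secondHat, abs_mul, abs_of_pos (by positivity : 0 < 1 / (N : ℝ)), one_div_mul_eq_div,
    div_le_iff₀ hN]
  refine (Finset.abs_sum_le_sum_abs _ _).trans ?_
  refine (Finset.sum_le_sum (g := fun _ => (κ ^ t) ^ 2 * M) fun i _ => ?_).trans ?_
  · rw [abs_mul, abs_of_pos (pow_pos (h1 t i).1 2)]
    exact mul_le_mul (pow_le_pow_left₀ (h1 t i).1.le (h1 t i).2 2) (hM _) (abs_nonneg _)
      (sq_nonneg _)
  · simp [mul_comm]

omit [∀ t, IsMarkovKernel (K t)] in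
lemma integral_sq_gammaHat_zero_sub_le (h : IsRun P π₀ K g C X α) (hN : 1 ≤ N)
    (hφ : Measurable φ) {M : ℝ} (hM : ∀ x, |φ x| ≤ M) :
    ∫ ω, (gammaHat g (fun s => X s ω) (fun s => α s ω) 0 φ - ∫ x, φ x ∂π₀) ^ 2 ∂P
      ≤ (2 * M) ^ 2 / N := by
  have := h.condIID_zero.integral_sq_mean_sub_le measurable_const (h.measurable_particles 0) hN
    (f := fun p => φ p.2) (hφ.comp measurable_snd) (fun p => hM _)
  simpa [gammaHat, weight] using this

omit [∀ t, IsMarkovKernel (K t)] in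
lemma integral_sq_secondHat_zero_sub_le (h : IsRun P π₀ K g C X α) (hN : 1 ≤ N)
    (hφ : Measurable φ) {M : ℝ} (hM : ∀ x, |φ x| ≤ M) :
    ∫ ω, (secondHat g (fun s => X s ω) (fun s => α s ω) 0 φ - ∫ x, φ x ∂π₀) ^ 2 ∂P
      ≤ (2 * M) ^ 2 / N := by
  have := h.condIID_zero.integral_sq_mean_sub_le measurable_const (h.measurable_particles 0) hN
    (f := fun p => φ p.2) (hφ.comp measurable_snd) (fun p => hM _)
  simpa [secondHat, weight] using this

/-- Used with k = 1 for `gammaHat` and k = 2 for `secondHat`: each is within O(1/N) in mean square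
of its conditional mean given the previous weighted sample. -/
lemma integral_sq_mean_clampedMoment_sub_le (h : IsRun P π₀ K g C X α) (hg : IsPotential g κ)
    (hC : 1 ≤ C) (hCN : C ≤ N) (hκ : 0 ≤ κ) (hφ : Measurable φ) {M : ℝ} (hM : ∀ x, |φ x| ≤ M)
    (t k : ℕ) :
    ∫ ω, (1 / (N : ℝ) * ∑ i, weight g (fun s => X s ω) (fun s => α s ω) (t + 1) i ^ k
        * φ (X (t + 1) ω i) - ∫ z, clampedMoment (κ ^ (t + 1)) k φ
          (weightedSample g (fun s => X s ω) (fun s => α s ω) t, z) ∂rowMove π₀ (K (t + 1)) C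
          (weightedSample g (fun s => X s ω) (fun s => α s ω) t)) ^ 2 ∂P
      ≤ (2 * ((κ ^ (t + 1)) ^ k * M)) ^ 2 / N := by
  have := isMarkovKernel_rowMove (N := N) π₀ (K (t + 1)) hCN
  refine le_of_eq_of_le (integral_congr_ae ?_)
    ((h.condIID_succ hg hC hCN t).integral_sq_mean_sub_le
    (h.measurable_weightedSample hg.measurable t)
    (measurable_pi_lambda _ fun i => ((measurable_pi_apply i).comp (h.measurable_matrix t)).prodMk
      (h.measurable_particle (t + 1) i)) (hC.trans hCN)
    (measurable_clampedMoment hφ k) (abs_clampedMoment_le (pow_nonneg hκ _) hM k))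
  filter_upwards [h.ae_clampedMoment (φ := φ) hg hC hCN t k] with ω h1
  simp only [h1]

end IsRun

/-! ### Consistency at the rate `N^{-1/2}` in `L²` -/

/-- The uniformly bounded estimators `A N` of the number `a` have mean square error `O(1 / N)`. -/
structure RootNConsistent {C : ℕ} {Ω : Set.Ici C → Type*} [∀ N, MeasurableSpace (Ω N)]
    (P : ∀ N, Measure (Ω N)) (A : ∀ N, Ω N → ℝ) (a : ℝ) : Prop where
  measurable : ∀ N, Measurable (A N)
  bounded : ∃ b, 0 ≤ b ∧ ∀ N, ∀ᵐ ω ∂P N, |A N ω| ≤ b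
  rate : ∃ c, ∀ N : Set.Ici C, ∫ ω, (A N ω - a) ^ 2 ∂P N ≤ c / ((N : ℕ) : ℝ)

namespace RootNConsistent

variable {C : ℕ} {Ω : Set.Ici C → Type*} [∀ N, MeasurableSpace (Ω N)]
  {P : ∀ N, Measure (Ω N)} [∀ N, IsProbabilityMeasure (P N)] {A B : ∀ N, Ω N → ℝ} {a b : ℝ}

omit [∀ N, IsProbabilityMeasure (P N)] in
lemma ae_abs_sub_le (hA : RootNConsistent P A a) (x : ℝ) :
    ∃ M, 0 ≤ M ∧ ∀ N, ∀ᵐ ω ∂P N, |A N ω - x| ≤ M := by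
  obtain ⟨b, hb0, hb⟩ := hA.bounded
  refine ⟨b + |x|, by positivity, fun N => ?_⟩
  filter_upwards [hb N] with ω h
  exact (abs_sub _ _).trans (by gcongr)

lemma integrable_sq_sub (hA : RootNConsistent P A a) (x : ℝ) (N : Set.Ici C) :
    Integrable (fun ω => (A N ω - x) ^ 2) (P N) := by
  obtain ⟨M, hM0, hM⟩ := hA.ae_abs_sub_le x
  refine Integrable.of_bound (((hA.measurable N).sub_const x).pow_const 2).aestronglyMeasurable
    (M ^ 2) ?_
  filter_upwards [hM N] with ω h
  rw [Real.norm_eq_abs, abs_pow]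
  gcongr

/-- The mean square error of `A` is controlled by those of two other estimators. -/
lemma of_sq_sub_le {A' : ∀ N, Ω N → ℝ} {a' : ℝ} (hA : RootNConsistent P A a)
    (hB : RootNConsistent P B b) (hm : ∀ N, Measurable (A' N))
    (hb : ∃ M, 0 ≤ M ∧ ∀ N, ∀ᵐ ω ∂P N, |A' N ω| ≤ M) {p q : ℝ} (hp : 0 ≤ p) (hq : 0 ≤ q)
    (h : ∀ N, ∀ᵐ ω ∂P N, (A' N ω - a') ^ 2 ≤ p * (A N ω - a) ^ 2 + q * (B N ω - b) ^ 2) :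
    RootNConsistent P A' a' := by
  refine ⟨hm, hb, ?_⟩
  obtain ⟨c, hc⟩ := hA.rate
  obtain ⟨d, hd⟩ := hB.rate
  refine ⟨p * c + q * d, fun N => ?_⟩
  have hiA := (hA.integrable_sq_sub a N).const_mul p
  have hiB := (hB.integrable_sq_sub b N).const_mul q
  calc ∫ ω, (A' N ω - a') ^ 2 ∂P N
      ≤ ∫ ω, (p * (A N ω - a) ^ 2 + q * (B N ω - b) ^ 2) ∂P N :=
        integral_mono_of_nonneg (ae_of_all _ fun _ => sq_nonneg _) (hiA.add hiB) (h N)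
    _ = p * ∫ ω, (A N ω - a) ^ 2 ∂P N + q * ∫ ω, (B N ω - b) ^ 2 ∂P N := by
        rw [integral_add hiA hiB, integral_const_mul, integral_const_mul]
    _ ≤ p * (c / ((N : ℕ) : ℝ)) + q * (d / ((N : ℕ) : ℝ)) := by
        gcongr
        · exact hc N
        · exact hd N
    _ = (p * c + q * d) / ((N : ℕ) : ℝ) := by ring

lemma add (hA : RootNConsistent P A a) (hB : RootNConsistent P B b) :
    RootNConsistent P (fun N ω => A N ω + B N ω) (a + b) := by
  refine of_sq_sub_le hA hB (fun N => (hA.measurable N).add (hB.measurable N)) ?_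
    (p := 2) (q := 2) (by norm_num) (by norm_num) fun N => ae_of_all _ fun ω => ?_
  · obtain ⟨M, hM0, hM⟩ := hA.bounded
    obtain ⟨M', hM0', hM'⟩ := hB.bounded
    refine ⟨M + M', by positivity, fun N => ?_⟩
    filter_upwards [hM N, hM' N] with ω h h'
    exact (abs_add_le _ _).trans (add_le_add h h')
  · nlinarith [sq_nonneg (A N ω - a - (B N ω - b))]

lemma mul (hA : RootNConsistent P A a) (hB : RootNConsistent P B b) :
    RootNConsistent P (fun N ω => A N ω * B N ω) (a * b) := by
  obtain ⟨M, hM0, hM⟩ := hA.bounded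
  obtain ⟨M', hM0', hM'⟩ := hB.bounded
  refine of_sq_sub_le hA hB (fun N => (hA.measurable N).mul (hB.measurable N)) ?_
    (p := 2 * b ^ 2) (q := 2 * M ^ 2) (by positivity) (by positivity) fun N => ?_
  · refine ⟨M * M', by positivity, fun N => ?_⟩
    filter_upwards [hM N, hM' N] with ω h h'
    rw [abs_mul]
    exact mul_le_mul h h' (abs_nonneg _) hM0
  · filter_upwards [hM N] with ω h
    have h1 : A N ω ^ 2 ≤ M ^ 2 := sq_le_sq' (neg_le_of_abs_le h) (le_of_abs_le h)
    have h2 := mul_le_mul_of_nonneg_right h1 (sq_nonneg (B N ω - b))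
    have e : A N ω * B N ω - a * b = A N ω * (B N ω - b) + b * (A N ω - a) := by ring
    rw [e]
    nlinarith [sq_nonneg (A N ω * (B N ω - b) - b * (A N ω - a))]

lemma const_mul (hA : RootNConsistent P A a) (x : ℝ) :
    RootNConsistent P (fun N ω => x * A N ω) (x * a) := by
  obtain ⟨M, hM0, hM⟩ := hA.bounded
  refine of_sq_sub_le hA hA (fun N => (hA.measurable N).const_mul x) ?_
    (p := x ^ 2) (q := 0) (by positivity) le_rfl fun N => ae_of_all _ fun ω => ?_
  · refine ⟨|x| * M, by positivity, fun N => ?_⟩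
    filter_upwards [hM N] with ω h
    rw [abs_mul]
    gcongr
  · rw [← mul_sub, mul_pow]; linarith

lemma sub (hA : RootNConsistent P A a) (hB : RootNConsistent P B b) :
    RootNConsistent P (fun N ω => A N ω - B N ω) (a - b) := by
  simpa [sub_eq_add_neg] using hA.add (hB.const_mul (-1))

/-- An estimator that is close to a consistent one in mean square is consistent. -/
lemma of_close (hA : RootNConsistent P A a) (hm : ∀ N, Measurable (B N))
    (hb : ∃ M, 0 ≤ M ∧ ∀ N, ∀ᵐ ω ∂P N, |B N ω| ≤ M)
    (h : ∃ c, ∀ N : Set.Ici C, ∫ ω, (B N ω - A N ω) ^ 2 ∂P N ≤ c / ((N : ℕ) : ℝ)) :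
    RootNConsistent P B a := by
  obtain ⟨M, hM0, hM⟩ := hA.bounded
  obtain ⟨M', hM0', hM'⟩ := hb
  have hD : RootNConsistent P (fun N ω => B N ω - A N ω) 0 := by
    refine ⟨fun N => (hm N).sub (hA.measurable N), ⟨M' + M, by positivity, fun N => ?_⟩, ?_⟩
    · filter_upwards [hM N, hM' N] with ω h h'
      exact (abs_sub _ _).trans (add_le_add h' h)
    · simpa using h
  simpa using hA.add hD

/-- From |x| ≤ (√N/2) x² + 1/(2√N), which balances the two terms and produces the constant (c +
1)/2. In this form the consistency of the conditional variance enters the Gaussian approximation. -/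
lemma integral_abs_sub_le (hA : RootNConsistent P A a) :
    ∃ c, ∀ N : Set.Ici C, 1 ≤ (N : ℕ) → ∫ ω, |A N ω - a| ∂P N ≤ c / √((N : ℕ) : ℝ) := by
  obtain ⟨c, hc⟩ := hA.rate
  refine ⟨(c + 1) / 2, fun N hN => ?_⟩
  have hN0 : (0 : ℝ) < (N : ℕ) := by exact_mod_cast hN
  have hs : 0 < √((N : ℕ) : ℝ) := Real.sqrt_pos.2 hN0
  have hss : √((N : ℕ) : ℝ) * √((N : ℕ) : ℝ) = (N : ℕ) := Real.mul_self_sqrt hN0.le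
  have hi : Integrable (fun ω => √((N : ℕ) : ℝ) / 2 * (A N ω - a) ^ 2) (P N) :=
    (hA.integrable_sq_sub a N).const_mul _
  calc ∫ ω, |A N ω - a| ∂P N
      ≤ ∫ ω, (√((N : ℕ) : ℝ) / 2 * (A N ω - a) ^ 2 + 1 / (2 * √((N : ℕ) : ℝ))) ∂P N := by
        refine integral_mono_of_nonneg (ae_of_all _ fun _ => abs_nonneg _)
          (hi.add (integrable_const _)) (ae_of_all _ fun ω => ?_)
        dsimp only
        rw [← sq_abs, ← sub_nonneg]
        have : √((N : ℕ) : ℝ) / 2 * |A N ω - a| ^ 2 + 1 / (2 * √((N : ℕ) : ℝ)) - |A N ω - a|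
            = (√((N : ℕ) : ℝ) * |A N ω - a| - 1) ^ 2 / (2 * √((N : ℕ) : ℝ)) := by
          field_simp
          ring
        rw [this]
        positivity
    _ = √((N : ℕ) : ℝ) / 2 * ∫ ω, (A N ω - a) ^ 2 ∂P N + 1 / (2 * √((N : ℕ) : ℝ)) := by
        rw [integral_add hi (integrable_const _), integral_const_mul]
        simp
    _ ≤ √((N : ℕ) : ℝ) / 2 * (c / ((N : ℕ) : ℝ)) + 1 / (2 * √((N : ℕ) : ℝ)) := by
        gcongr
        exact hc N
    _ = (c + 1) / 2 / √((N : ℕ) : ℝ) := by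
        have e : c / ((N : ℕ) : ℝ) = c / (√((N : ℕ) : ℝ) * √((N : ℕ) : ℝ)) := by rw [hss]
        rw [e]
        field_simp

end RootNConsistent

lemma tendsto_sqrt_atTop (C : ℕ) :
    Tendsto (fun N : Set.Ici C => √((N : ℕ) : ℝ)) atTop atTop := by
  have h : Tendsto (fun N : Set.Ici C => (N : ℕ)) atTop atTop :=
    tendsto_atTop.2 fun n => (eventually_ge_atTop (⟨max n C, Set.mem_Ici.2 (le_max_right n C)⟩ : Set.Ici C)).mono
      fun N hN => (le_max_left n C).trans hN
  exact Real.tendsto_sqrt_atTop.comp (tendsto_natCast_atTop_atTop.comp h)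

lemma tendsto_const_div_sqrt (C : ℕ) (c : ℝ) :
    Tendsto (fun N : Set.Ici C => c / √((N : ℕ) : ℝ)) atTop (nhds 0) :=
  tendsto_const_nhds.div_atTop (tendsto_sqrt_atTop C)

/-! ### Consistency of the particle approximations -/

section Family

variable {π₀ : Measure S} [IsProbabilityMeasure π₀] {K : ℕ → Kernel S S}
  [∀ t, IsMarkovKernel (K t)] {g : ℕ → S → ℝ} {κ : ℝ} {C : ℕ}
  {Ω : Set.Ici C → Type*} [∀ N, MeasurableSpace (Ω N)]
  {P : ∀ N, Measure (Ω N)} [∀ N, IsProbabilityMeasure (P N)]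
  {X : ∀ N : Set.Ici C, ℕ → Ω N → Fin (N : ℕ) → S}
  {α : ∀ N : Set.Ici C, ℕ → Ω N → Fin (N : ℕ) → Fin (N : ℕ) → ℝ}

/-- By induction: γ̂_{t+1}(φ) is within O(1/N) in mean square of its conditional mean γ̂_t(Q φ),
which estimates γ_t(Q φ) = γ_{t+1}(φ). -/
theorem rootNConsistent_gammaHat (hg : IsPotential g κ) (hκ : 0 ≤ κ) (hC : 1 ≤ C)
    (hR : ∀ N, IsRun (P N) π₀ K g C (X N) (α N)) (t : ℕ) {φ : S → ℝ} (hφ : IsTestFunction φ) :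
    RootNConsistent P
      (fun N ω => gammaHat g (fun s => X N s ω) (fun s => α N s ω) t φ)
      (gammaTarget π₀ K g t φ) := by
  have hCN : ∀ N : Set.Ici C, C ≤ (N : ℕ) := fun N => N.2
  have hm : ∀ t N, Measurable fun ω => gammaHat g (fun s => X N s ω) (fun s => α N s ω) t φ :=
    fun t N => (hR N).measurable_gammaHat hg.measurable t hφ.1
  obtain ⟨M, hM0, hM⟩ := hφ.exists_pos_bound
  have hb : ∀ t, ∃ b, 0 ≤ b ∧ ∀ N, ∀ᵐ ω ∂P N,
      |gammaHat g (fun s => X N s ω) (fun s => α N s ω) t φ| ≤ b := fun t =>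
    ⟨κ ^ t * M, by positivity, fun N => (hR N).ae_abs_gammaHat_le hg hC (hCN N) hM t⟩
  induction t generalizing φ M with
  | zero =>
    exact ⟨hm 0, hb 0, _, fun N =>
      (hR N).integral_sq_gammaHat_zero_sub_le (hC.trans (hCN N)) hφ.1 hM⟩
  | succ t ih =>
    rw [gammaTarget_succ]
    have hQ := hφ.qop (K := K) hg t
    obtain ⟨M', hM0', hM'⟩ := hQ.exists_pos_bound
    have h1 := ih hQ (fun t N => (hR N).measurable_gammaHat hg.measurable t hQ.1) M' hM0' hM'
      fun t => ⟨κ ^ t * M', by positivity, fun N =>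
        (hR N).ae_abs_gammaHat_le hg hC (hCN N) hM' t⟩
    refine h1.of_close (hm _) (hb _) ⟨(2 * ((κ ^ (t + 1)) ^ 1 * M)) ^ 2, fun N => ?_⟩
    refine le_of_eq_of_le (integral_congr_ae ?_)
      ((hR N).integral_sq_mean_clampedMoment_sub_le hg hC (hCN N) hκ hφ.1 hM t 1)
    filter_upwards [(hR N).ae_integral_clampedMoment_one hg hC (hCN N) hκ hφ t] with ω h2
    simp only [h2, gammaHat, pow_one]

/-- The conditional second moment of a new weighted particle is consistent when the second-moment
approximation of the previous step is. -/
lemma rootNConsistent_integral_clampedMoment_two (hg : IsPotential g κ) (hκ : 0 ≤ κ) (hC : 1 ≤ C)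
    (hR : ∀ N, IsRun (P N) π₀ K g C (X N) (α N)) (t : ℕ) {φ : S → ℝ} (hφ : IsTestFunction φ)
    (h2 : RootNConsistent P
      (fun N ω => secondHat g (fun s => X N s ω) (fun s => α N s ω) t (QopSq K g t φ))
      (muTarget π₀ K g C t (QopSq K g t φ))) :
    RootNConsistent P
      (fun N ω => ∫ z, clampedMoment (κ ^ (t + 1)) 2 φ
        (weightedSample g (fun s => X N s ω) (fun s => α N s ω) t, z) ∂rowMove π₀ (K (t + 1)) C
          (weightedSample g (fun s => X N s ω) (fun s => α N s ω) t))
      (muTarget π₀ K g C (t + 1) φ) := by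
  have hCN : ∀ N : Set.Ici C, C ≤ (N : ℕ) := fun N => N.2
  have hC1 : (1 : ℝ) ≤ C := by exact_mod_cast hC
  obtain ⟨M, hM0, hM⟩ := hφ.exists_pos_bound
  have h3 := rootNConsistent_gammaHat hg hκ hC hR t (hg.isTestFunction t)
  have h4 := rootNConsistent_gammaHat hg hκ hC hR t (hφ.qop (K := K) hg t)
  have h5 := (h2.const_mul (1 / (C : ℝ))).add ((h3.mul h4).const_mul (((C : ℝ) - 1) / C))
  rw [← muTarget_succ hg] at h5
  refine h5.of_close (fun N => ?_) ⟨(κ ^ (t + 1)) ^ 2 * M, by positivity, fun N => ?_⟩ ?_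
  · have := isMarkovKernel_rowMove (N := (N : ℕ)) π₀ (K (t + 1)) (hCN N)
    exact ((measurable_clampedMoment (N := (N : ℕ)) hφ.1 2).stronglyMeasurable
      |>.integral_kernel_prod_right' (κ := rowMove π₀ (K (t + 1)) C)).measurable.comp
        ((hR N).measurable_weightedSample hg.measurable t)
  · have := isMarkovKernel_rowMove (N := (N : ℕ)) π₀ (K (t + 1)) (hCN N)
    exact ae_of_all _ fun ω => abs_integral_le_of_abs_le fun z =>
      abs_clampedMoment_le (pow_nonneg hκ _) hM 2 _
  · obtain ⟨b2, hb20, hb2⟩ := h2.bounded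
    obtain ⟨b3, hb30, hb3⟩ := (h3.mul h4).bounded
    refine ⟨(2 * (b3 + b2)) ^ 2, fun N => ?_⟩
    have hN1 : (1 : ℝ) ≤ (N : ℕ) := by exact_mod_cast hC.trans (hCN N)
    have hle : ∀ᵐ ω ∂P N, ((∫ z, clampedMoment (κ ^ (t + 1)) 2 φ
        (weightedSample g (fun s => X N s ω) (fun s => α N s ω) t, z) ∂rowMove π₀ (K (t + 1)) C
          (weightedSample g (fun s => X N s ω) (fun s => α N s ω) t))
        - (1 / (C : ℝ) * secondHat g (fun s => X N s ω) (fun s => α N s ω) t (QopSq K g t φ)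
          + ((C : ℝ) - 1) / C * (gammaHat g (fun s => X N s ω) (fun s => α N s ω) t (g t)
            * gammaHat g (fun s => X N s ω) (fun s => α N s ω) t (Qop K g t φ)))) ^ 2
        ≤ (2 * (b3 + b2)) ^ 2 / (N : ℕ) := by
      filter_upwards [(hR N).ae_integral_clampedMoment_two hg hC (hCN N) hκ hφ t, hb2 N, hb3 N]
        with ω e1 e2 e3
      rw [e1]
      set s := secondHat g (fun s => X N s ω) (fun s => α N s ω) t (QopSq K g t φ)
      set p := gammaHat g (fun s => X N s ω) (fun s => α N s ω) t (g t)
      set q := gammaHat g (fun s => X N s ω) (fun s => α N s ω) t (Qop K g t φ)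
      -- N = 1 forces C = 1, and the factor C - 1 removes the term with denominator N - 1. Otherwise
      -- N ≤ 2(N - 1), the source of the factor 2 in the bound.
      rcases eq_or_lt_of_le (hC.trans (hCN N)) with hN | hN
      · have : C = 1 := le_antisymm ((hCN N).trans hN.symm.le) hC
        have hC' : (C : ℝ) = 1 := by exact_mod_cast this
        rw [hC']
        simp only [sub_self, zero_div, zero_mul, add_zero]
        rw [zero_pow two_ne_zero]
        positivity
      · have hN2 : (2 : ℝ) ≤ (N : ℕ) := by exact_mod_cast hN
        set n : ℝ := ((N : ℕ) : ℝ)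
        have hn0 : n - 1 ≠ 0 := by linarith
        have hn0' : n ≠ 0 := by linarith
        have hC0 : (C : ℝ) ≠ 0 := by linarith
        -- Only the sampling without replacement separates the exact moment from the limiting
        -- recursion: the denominator n(n - 1) in place of n² and the missing diagonal combine into
        -- (pq - s)/(n - 1).
        have e : 1 / (C : ℝ) * s + ((C : ℝ) - 1) / (C * (n * (n - 1)))
              * (n * p * (n * q) - n * s)
            - (1 / (C : ℝ) * s + ((C : ℝ) - 1) / C * (p * q))
            = ((C : ℝ) - 1) / C * ((p * q - s) / (n - 1)) := by
          field_simp
          ring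
        rw [e]
        have f1 : |((C : ℝ) - 1) / C| ≤ 1 := by
          rw [abs_of_nonneg (div_nonneg (by linarith) (by linarith)), div_le_one (by linarith)]
          linarith
        have f2 : |p * q - s| ≤ b3 + b2 := (abs_sub _ _).trans (add_le_add e3 e2)
        have f3 : |(p * q - s) / (n - 1)| ≤ 2 * (b3 + b2) / n := by
          rw [abs_div, abs_of_pos (by linarith : 0 < n - 1), div_le_div_iff₀ (by linarith)
            (by linarith)]
          have f4 : n ≤ 2 * (n - 1) := by linarith
          calc |p * q - s| * n ≤ (b3 + b2) * (2 * (n - 1)) :=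
                mul_le_mul f2 f4 (by linarith) (by linarith)
            _ = 2 * (b3 + b2) * (n - 1) := by ring
        have f5 : |((C : ℝ) - 1) / C * ((p * q - s) / (n - 1))| ≤ 2 * (b3 + b2) / n := by
          rw [abs_mul]
          calc _ ≤ 1 * (2 * (b3 + b2) / n) := mul_le_mul f1 f3 (abs_nonneg _) zero_le_one
            _ = _ := one_mul _
        rw [← sq_abs]
        calc _ ≤ (2 * (b3 + b2) / n) ^ 2 := by gcongr
          _ = (2 * (b3 + b2)) ^ 2 / n * (1 / n) := by field_simp
          _ ≤ (2 * (b3 + b2)) ^ 2 / n * 1 := by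
            gcongr
            rw [div_le_one (by linarith)]
            linarith
          _ = _ := mul_one _
    calc _ ≤ ∫ _, (2 * (b3 + b2)) ^ 2 / ((N : ℕ) : ℝ) ∂P N :=
          integral_mono_of_nonneg (ae_of_all _ fun _ => sq_nonneg _) (integrable_const _) hle
      _ = _ := by simp

/-- The induction for γ̂ is repeated one moment higher; the recursion closes because its only other
ingredient is a product of two `gammaHat`, already consistent. -/
theorem rootNConsistent_secondHat (hg : IsPotential g κ) (hκ : 0 ≤ κ) (hC : 1 ≤ C)
    (hR : ∀ N, IsRun (P N) π₀ K g C (X N) (α N)) (t : ℕ) {φ : S → ℝ} (hφ : IsTestFunction φ) :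
    RootNConsistent P
      (fun N ω => secondHat g (fun s => X N s ω) (fun s => α N s ω) t φ)
      (muTarget π₀ K g C t φ) := by
  have hCN : ∀ N : Set.Ici C, C ≤ (N : ℕ) := fun N => N.2
  induction t generalizing φ with
  | zero =>
    obtain ⟨M, hM0, hM⟩ := hφ.exists_pos_bound
    exact ⟨fun N => (hR N).measurable_secondHat hg.measurable 0 hφ.1,
      ⟨(κ ^ 0) ^ 2 * M, by positivity, fun N => (hR N).ae_abs_secondHat_le hg hC (hCN N) hM 0⟩,
      _, fun N => (hR N).integral_sq_secondHat_zero_sub_le (hC.trans (hCN N)) hφ.1 hM⟩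
  | succ t ih =>
    obtain ⟨M, hM0, hM⟩ := hφ.exists_pos_bound
    refine (rootNConsistent_integral_clampedMoment_two hg hκ hC hR t hφ
      (ih (hφ.qopSq hg t))).of_close
      (fun N => (hR N).measurable_secondHat hg.measurable _ hφ.1)
      ⟨(κ ^ (t + 1)) ^ 2 * M, by positivity, fun N =>
        (hR N).ae_abs_secondHat_le hg hC (hCN N) hM _⟩
      ⟨(2 * ((κ ^ (t + 1)) ^ 2 * M)) ^ 2, fun N =>
        (hR N).integral_sq_mean_clampedMoment_sub_le hg hC (hCN N) hκ hφ.1 hM t 2⟩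

end Family

/-! ### The central limit theorem -/

lemma div_sqrt_mul_sum_sub {N : ℕ} (hN : 1 ≤ N) (u m : ℝ) (f : Fin N → ℝ) :
    u / √N * ∑ i, (f i - m) = u * (√N * (1 / (N : ℝ) * ∑ i, f i - m)) := by
  have hN0 : (0 : ℝ) < N := by exact_mod_cast hN
  have hs : 0 < √(N : ℝ) := Real.sqrt_pos.2 hN0
  have hss : √(N : ℝ) * √(N : ℝ) = N := Real.mul_self_sqrt hN0.le
  rw [Finset.sum_sub_distrib]
  simp only [Finset.sum_const, Finset.card_univ, Fintype.card_fin, nsmul_eq_mul]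
  field_simp
  rw [sq, hss]

lemma div_le_div_sqrt {n w : ℝ} (hn : 1 ≤ n) (hw : 0 ≤ w) : w / n ≤ w / √n := by
  refine div_le_div_of_nonneg_left hw (Real.sqrt_pos.2 (by linarith)) ?_
  exact Real.sqrt_le_iff.2 ⟨by linarith, by nlinarith⟩

lemma measurable_cexp_mul_I {T : Type*} [MeasurableSpace T] {f : T → ℝ} (hf : Measurable f) :
    Measurable fun z => Complex.exp ((f z : ℂ) * Complex.I) := by
  fun_prop

lemma norm_cexp_mul_I_sub_le (x y : ℝ) :
    ‖Complex.exp (x * Complex.I) - Complex.exp (y * Complex.I)‖ ≤ |x - y| := by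
  have e : Complex.exp (x * Complex.I) - Complex.exp (y * Complex.I)
      = Complex.exp (y * Complex.I) * (Complex.exp (Complex.I * ((x - y : ℝ) : ℂ)) - 1) := by
    rw [mul_sub, ← Complex.exp_add, mul_one]
    congr 2
    push_cast
    ring
  rw [e, norm_mul, Complex.norm_exp_ofReal_mul_I, one_mul]
  exact Real.norm_exp_I_mul_ofReal_sub_one_le

section Family

variable {π₀ : Measure S} [IsProbabilityMeasure π₀] {K : ℕ → Kernel S S}
  [∀ t, IsMarkovKernel (K t)] {g : ℕ → S → ℝ} {κ : ℝ} {C : ℕ}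
  {Ω : Set.Ici C → Type*} [∀ N, MeasurableSpace (Ω N)]
  {P : ∀ N, Measure (Ω N)} [∀ N, IsProbabilityMeasure (P N)]
  {X : ∀ N : Set.Ici C, ℕ → Ω N → Fin (N : ℕ) → S}
  {α : ∀ N : Set.Ici C, ℕ → Ω N → Fin (N : ℕ) → Fin (N : ℕ) → ℝ}

/-- One step of the induction: the characteristic function of the error at time `t + 1` is
asymptotically that of the error at time `t`, times that of a centred Gaussian variable. -/
lemma tendsto_charFun_gammaHat_step (hg : IsPotential g κ) (hκ : 0 ≤ κ) (hC : 1 ≤ C)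
    (hR : ∀ N, IsRun (P N) π₀ K g C (X N) (α N)) (t : ℕ) {φ : S → ℝ} (hφ : IsTestFunction φ)
    (u : ℝ) :
    Tendsto (fun N : Set.Ici C =>
      (∫ ω, Complex.exp (((u * (√(N : ℕ) * (gammaHat g (fun s => X N s ω) (fun s => α N s ω) (t + 1) φ
          - gammaTarget π₀ K g (t + 1) φ)) : ℝ) : ℂ) * Complex.I) ∂P N)
      - (Real.exp (-(u ^ 2 * (muTarget π₀ K g C (t + 1) (fun x => φ x ^ 2)
          - gammaTarget π₀ K g (t + 1) φ ^ 2) / 2)) : ℂ)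
        * ∫ ω, Complex.exp (((u * (√(N : ℕ) * (gammaHat g (fun s => X N s ω) (fun s => α N s ω) t
            (Qop K g t φ) - gammaTarget π₀ K g t (Qop K g t φ))) : ℝ) : ℂ) * Complex.I) ∂P N)
      atTop (nhds 0) := by
  have hCN : ∀ N : Set.Ici C, C ≤ (N : ℕ) := fun N => N.2
  obtain ⟨M, hM0, hM⟩ := hφ.exists_pos_bound
  set v := muTarget π₀ K g C (t + 1) (fun x => φ x ^ 2) - gammaTarget π₀ K g (t + 1) φ ^ 2 with hv
  have hv0 : 0 ≤ v := sub_nonneg.2 (sq_gammaTarget_le_muTarget hg hC hφ _)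
  have h1 := rootNConsistent_integral_clampedMoment_two hg hκ hC hR t hφ.sq
    (rootNConsistent_secondHat hg hκ hC hR t (hφ.sq.qopSq hg t))
  have h2 := rootNConsistent_gammaHat hg hκ hC hR t (hφ.qop (K := K) hg t)
  -- Second moment minus squared mean: the conditional variance of a new weighted value approaches
  -- the constant v.
  have h3 := h1.sub (h2.mul h2)
  rw [← gammaTarget_succ, ← sq, ← hv] at h3
  obtain ⟨c, hc⟩ := h3.integral_abs_sub_le
  set b := (κ ^ (t + 1)) ^ 1 * M
  refine squeeze_zero_norm (fun N => ?_) (tendsto_const_div_sqrt C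
    (4 * (2 * |u| * b) ^ 3 + u ^ 2 / 2 * c + (u ^ 2 * v / 2) ^ 2))
  have hN := hC.trans (hCN N)
  have hN1 : (1 : ℝ) ≤ (N : ℕ) := by exact_mod_cast hN
  have hmk := isMarkovKernel_rowMove (N := (N : ℕ)) π₀ (K (t + 1)) (hCN N)
  set ρ := rowMove (N := (N : ℕ)) π₀ (K (t + 1)) C
  set Y := fun ω => weightedSample g (fun s => X N s ω) (fun s => α N s ω) t
  have hcm := measurable_clampedMoment (N := (N : ℕ)) (b := κ ^ (t + 1)) hφ.1 1
  -- Θ is the error inherited from time t. It is written with the kernel integral, a measurable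
  -- function of y defined everywhere, which equals γ̂_t(Q φ) almost surely along the run.
  have hΘ : Measurable fun y => u * (√(N : ℕ) * ((∫ z, clampedMoment (κ ^ (t + 1)) 1 φ (y, z) ∂ρ y)
      - gammaTarget π₀ K g (t + 1) φ)) :=
    ((hcm.stronglyMeasurable.integral_kernel_prod_right' (κ := ρ)).measurable.sub_const _
      |>.const_mul _).const_mul _
  have key := ((hR N).condIID_succ hg hC (hCN N) t).norm_integral_cexp_sub_le
    ((hR N).measurable_weightedSample hg.measurable t) hN hcm
    (abs_clampedMoment_le (pow_nonneg hκ _) hM 1) hΘ u hv0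
  have e1 : ∀ᵐ ω ∂P N, ∫ z, clampedMoment (κ ^ (t + 1)) 1 φ (Y ω, z) ∂ρ (Y ω)
      = gammaHat g (fun s => X N s ω) (fun s => α N s ω) t (Qop K g t φ) :=
    (hR N).ae_integral_clampedMoment_one hg hC (hCN N) hκ hφ t
  have e2 : ∀ y : (Fin (N : ℕ) → ℝ) × (Fin (N : ℕ) → S),
      ∫ z, clampedMoment (κ ^ (t + 1)) 1 φ (y, z) ^ 2 ∂ρ y
      = ∫ z, clampedMoment (κ ^ (t + 1)) 2 (fun x => φ x ^ 2) (y, z) ∂ρ y := fun y => by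
    simp only [clampedMoment, pow_one, mul_pow]
  have f1 : ∫ ω, Complex.exp (((u * (√(N : ℕ) * ((∫ z, clampedMoment (κ ^ (t + 1)) 1 φ (Y ω, z)
        ∂ρ (Y ω)) - gammaTarget π₀ K g (t + 1) φ)) + u / √(N : ℕ)
        * ∑ i, (clampedMoment (κ ^ (t + 1)) 1 φ (Y ω, (α N t ω i, X N (t + 1) ω i))
          - ∫ z, clampedMoment (κ ^ (t + 1)) 1 φ (Y ω, z) ∂ρ (Y ω)) : ℝ) : ℂ) * Complex.I) ∂P N
      = ∫ ω, Complex.exp (((u * (√(N : ℕ) * (gammaHat g (fun s => X N s ω) (fun s => α N s ω)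
        (t + 1) φ - gammaTarget π₀ K g (t + 1) φ)) : ℝ) : ℂ) * Complex.I) ∂P N := by
    refine integral_congr_ae ?_
    filter_upwards [(hR N).ae_clampedMoment (φ := φ) hg hC (hCN N) t 1] with ω h4
    rw [div_sqrt_mul_sum_sub hN, ← mul_add, ← mul_add]
    simp only [Y, h4, gammaHat, pow_one]
    congr 5
    ring
  have f2 : ∫ ω, Complex.exp (((u * (√(N : ℕ) * ((∫ z, clampedMoment (κ ^ (t + 1)) 1 φ (Y ω, z)
        ∂ρ (Y ω)) - gammaTarget π₀ K g (t + 1) φ)) : ℝ) : ℂ) * Complex.I) ∂P N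
      = ∫ ω, Complex.exp (((u * (√(N : ℕ) * (gammaHat g (fun s => X N s ω) (fun s => α N s ω) t
        (Qop K g t φ) - gammaTarget π₀ K g t (Qop K g t φ))) : ℝ) : ℂ) * Complex.I) ∂P N := by
    refine integral_congr_ae ?_
    filter_upwards [e1] with ω h4
    rw [h4, gammaTarget_succ]
  have f3 : ∫ ω, |(∫ z, clampedMoment (κ ^ (t + 1)) 1 φ (Y ω, z) ^ 2 ∂ρ (Y ω))
        - (∫ z, clampedMoment (κ ^ (t + 1)) 1 φ (Y ω, z) ∂ρ (Y ω)) ^ 2 - v| ∂P N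
      ≤ c / √(N : ℕ) := by
    refine le_of_eq_of_le (integral_congr_ae ?_) (hc N hN)
    filter_upwards [e1] with ω h4
    rw [h4, e2, sq (gammaHat _ _ _ _ _)]
  rw [f1, f2] at key
  refine key.trans ?_
  have f4 : (u ^ 2 * v / 2) ^ 2 / ((N : ℕ) : ℝ) ≤ (u ^ 2 * v / 2) ^ 2 / √(N : ℕ) :=
    div_le_div_sqrt hN1 (sq_nonneg _)
  calc _ ≤ 4 * (2 * |u| * b) ^ 3 / √(N : ℕ) + u ^ 2 / 2 * (c / √(N : ℕ))
        + (u ^ 2 * v / 2) ^ 2 / √(N : ℕ) := by gcongr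
    _ = _ := by ring

/-- Each step multiplies the limit by a Gaussian factor and passes from φ to Q φ one time earlier;
the exponents add up exactly as in `asympVar`. -/
theorem tendsto_charFun_gammaHat (hg : IsPotential g κ) (hκ : 0 ≤ κ) (hC : 1 ≤ C)
    (hR : ∀ N, IsRun (P N) π₀ K g C (X N) (α N)) (t : ℕ) {φ : S → ℝ} (hφ : IsTestFunction φ)
    (u : ℝ) :
    Tendsto (fun N : Set.Ici C =>
      ∫ ω, Complex.exp (((u * (√(N : ℕ) * (gammaHat g (fun s => X N s ω) (fun s => α N s ω) t φ
          - gammaTarget π₀ K g t φ)) : ℝ) : ℂ) * Complex.I) ∂P N)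
      atTop (nhds (Real.exp (-(u ^ 2 * asympVar π₀ K g C t φ / 2)) : ℂ)) := by
  have hCN : ∀ N : Set.Ici C, C ≤ (N : ℕ) := fun N => N.2
  induction t generalizing φ with
  | zero =>
    obtain ⟨M, hM0, hM⟩ := hφ.exists_pos_bound
    have hv0 : 0 ≤ Var[φ; π₀] := variance_nonneg _ _
    have hvar : (∫ x, φ x ^ 2 ∂π₀) - (∫ x, φ x ∂π₀) ^ 2 = Var[φ; π₀] := by
      rw [variance_eq_sub (MemLp.of_bound hφ.1.aestronglyMeasurable M (ae_of_all _ hM))]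
      simp
    rw [← tendsto_sub_nhds_zero_iff]
    refine squeeze_zero_norm (fun N => ?_) (tendsto_const_div_sqrt C
      (4 * (2 * |u| * M) ^ 3 + (u ^ 2 * Var[φ; π₀] / 2) ^ 2))
    have hN := hC.trans (hCN N)
    have hN1 : (1 : ℝ) ≤ (N : ℕ) := by exact_mod_cast hN
    have key := (hR N).condIID_zero.norm_integral_cexp_sub_le measurable_const hN
      (f := fun p => φ p.2) (hφ.1.comp measurable_snd) (fun p => hM _)
      (Θ := fun _ => 0) measurable_const u hv0
    simp only [Kernel.const_apply, hvar, sub_self, abs_zero, zero_add, div_sqrt_mul_sum_sub hN,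
      integral_zero, mul_zero, add_zero, Complex.ofReal_zero, zero_mul, Complex.exp_zero,
      integral_const, probReal_univ, one_smul, mul_one] at key
    simp only [gammaHat, weight, one_mul, gammaTarget_zero, asympVar]
    refine key.trans ?_
    rw [add_div]
    exact add_le_add le_rfl (div_le_div_sqrt hN1 (sq_nonneg _))
  | succ t ih =>
    have h1 := tendsto_charFun_gammaHat_step hg hκ hC hR t hφ u
    have h2 := (ih (hφ.qop (K := K) hg t)).const_mul
      (Real.exp (-(u ^ 2 * (muTarget π₀ K g C (t + 1) (fun x => φ x ^ 2)
          - gammaTarget π₀ K g (t + 1) φ ^ 2) / 2)) : ℂ)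
    have h3 := h1.add h2
    simp only [sub_add_cancel, zero_add] at h3
    convert h3 using 2
    rw [← Complex.ofReal_mul, ← Real.exp_add, asympVar]
    congr 2
    ring

end Family

/-! ### The self-normalised estimator -/

omit [MeasurableSpace S] in
lemma piHat_sub_eq_div {N : ℕ} {g : ℕ → S → ℝ} {x : ℕ → Fin N → S}
    {a : ℕ → Fin N → Fin N → ℝ} {t : ℕ} (hN : 1 ≤ N) (hW : ∀ i, 0 < weight g x a t i)
    (φ : S → ℝ) (c : ℝ) :
    piHat g x a t φ - c
      = gammaHat g x a t (fun y => φ y - c) / gammaHat g x a t (fun _ => 1) := by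
  have : Nonempty (Fin N) := ⟨⟨0, hN⟩⟩
  have hN0 : (N : ℝ) ≠ 0 := by positivity
  have hs : 0 < ∑ i, weight g x a t i := Finset.sum_pos (fun i _ => hW i) Finset.univ_nonempty
  simp only [piHat, gammaHat, mul_one, mul_sub, Finset.sum_sub_distrib, ← Finset.sum_mul,
    div_mul_eq_mul_div, ← Finset.sum_div]
  field_simp

omit [MeasurableSpace S] in
lemma abs_gammaHat_div_le {N : ℕ} {g : ℕ → S → ℝ} {x : ℕ → Fin N → S}
    {a : ℕ → Fin N → Fin N → ℝ} {t : ℕ} (hN : 1 ≤ N) (hW : ∀ i, 0 < weight g x a t i)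
    {φ : S → ℝ} {M : ℝ} (hM : ∀ y, |φ y| ≤ M) :
    |gammaHat g x a t φ / gammaHat g x a t (fun _ => 1)| ≤ M := by
  have : Nonempty (Fin N) := ⟨⟨0, hN⟩⟩
  have hN0 : (0 : ℝ) < N := by exact_mod_cast hN
  have hs : 0 < ∑ i, weight g x a t i := Finset.sum_pos (fun i _ => hW i) Finset.univ_nonempty
  have e : gammaHat g x a t φ / gammaHat g x a t (fun _ => 1)
      = (∑ i, weight g x a t i * φ (x t i)) / ∑ i, weight g x a t i := by
    simp only [gammaHat, mul_one]
    field_simp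
  rw [e, abs_div, abs_of_pos hs, div_le_iff₀ hs, Finset.mul_sum]
  refine (Finset.abs_sum_le_sum_abs _ _).trans (Finset.sum_le_sum fun i _ => ?_)
  rw [abs_mul, abs_of_pos (hW i), mul_comm]
  exact mul_le_mul_of_nonneg_right (hM _) (hW i).le

section Family

variable {π₀ : Measure S} [IsProbabilityMeasure π₀] {K : ℕ → Kernel S S}
  [∀ t, IsMarkovKernel (K t)] {g : ℕ → S → ℝ} {κ : ℝ} {C : ℕ}
  {Ω : Set.Ici C → Type*} [∀ N, MeasurableSpace (Ω N)]
  {P : ∀ N, Measure (Ω N)} [∀ N, IsProbabilityMeasure (P N)]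
  {X : ∀ N : Set.Ici C, ℕ → Ω N → Fin (N : ℕ) → S}
  {α : ∀ N : Set.Ici C, ℕ → Ω N → Fin (N : ℕ) → Fin (N : ℕ) → ℝ}

/-- With ψ = φ - π_t(φ) the error is B/G, where B estimates γ_t(ψ) = 0 and G estimates Z_t.
Replacing G by Z_t changes it by a product of two errors of order N^{-1/2}, negligible after
multiplication by √N. -/
theorem tendsto_charFun_piHat (hg : IsPotential g κ) (hκ : 0 ≤ κ) (hC : 1 ≤ C)
    (hR : ∀ N, IsRun (P N) π₀ K g C (X N) (α N)) (t : ℕ) {φ : S → ℝ} (hφ : IsTestFunction φ)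
    (u : ℝ) :
    Tendsto (fun N : Set.Ici C =>
      ∫ ω, Complex.exp (((u * (√(N : ℕ) * (piHat g (fun s => X N s ω) (fun s => α N s ω) t φ
          - piTarget π₀ K g t φ)) : ℝ) : ℂ) * Complex.I) ∂P N)
      atTop (nhds (Real.exp (-(u ^ 2 * (asympVar π₀ K g C t (fun x => φ x - piTarget π₀ K g t φ)
        / normConst π₀ K g t ^ 2) / 2)) : ℂ)) := by
  have hCN : ∀ N : Set.Ici C, C ≤ (N : ℕ) := fun N => N.2
  have hψ := hφ.sub_const (piTarget π₀ K g t φ)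
  have hγ0 := gammaTarget_sub_piTarget (π₀ := π₀) (K := K) hg hφ t
  set c := piTarget π₀ K g t φ
  set ψ : S → ℝ := fun x => φ x - c with hψdef
  have hZ := normConst_pos (π₀ := π₀) (K := K) hg t
  obtain ⟨M, hM0, hM⟩ := hψ.exists_pos_bound
  have hB := rootNConsistent_gammaHat hg hκ hC hR t hψ
  have hD := rootNConsistent_gammaHat hg hκ hC hR t (IsTestFunction.const (S := S) 1)
  rw [hγ0] at hB
  change RootNConsistent P _ (normConst π₀ K g t) at hD
  set Z := normConst π₀ K g t with hZdef
  -- Evaluation at u/Z is what divides the variance by Z².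
  have h1 := tendsto_charFun_gammaHat hg hκ hC hR t hψ (u / Z)
  rw [hγ0] at h1
  have e1 : (u / Z) ^ 2 * asympVar π₀ K g C t ψ / 2
      = u ^ 2 * (asympVar π₀ K g C t ψ / Z ^ 2) / 2 := by ring
  rw [e1] at h1
  obtain ⟨c1, hc1⟩ := hB.rate
  obtain ⟨c2, hc2⟩ := hD.rate
  suffices h : Tendsto (fun N : Set.Ici C =>
      (∫ ω, Complex.exp (((u * (√(N : ℕ) * (piHat g (fun s => X N s ω) (fun s => α N s ω) t φ
          - c)) : ℝ) : ℂ) * Complex.I) ∂P N)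
      - ∫ ω, Complex.exp (((u / Z * (√(N : ℕ) * (gammaHat g (fun s => X N s ω)
          (fun s => α N s ω) t ψ - 0)) : ℝ) : ℂ) * Complex.I) ∂P N) atTop (nhds 0) by
    have := h.add h1
    simpa only [sub_add_cancel, zero_add] using this
  refine squeeze_zero_norm (fun N => ?_) (tendsto_const_div_sqrt C
    (|u| / Z ^ 2 * (c1 / 2 + (1 / 2 + M) * c2)))
  have hN := hC.trans (hCN N)
  have hN0 : (0 : ℝ) < (N : ℕ) := by exact_mod_cast hN
  have hs : 0 < √((N : ℕ) : ℝ) := Real.sqrt_pos.2 hN0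
  have hss : √((N : ℕ) : ℝ) * √((N : ℕ) : ℝ) = (N : ℕ) := Real.mul_self_sqrt hN0.le
  have hm1 : Measurable fun ω => u * (√(N : ℕ) * (piHat g (fun s => X N s ω)
      (fun s => α N s ω) t φ - c)) :=
    (((hR N).measurable_piHat hg.measurable t hφ.1).sub_const _ |>.const_mul _).const_mul _
  have hm2 : Measurable fun ω => u / Z * (√(N : ℕ) * (gammaHat g (fun s => X N s ω)
      (fun s => α N s ω) t ψ - 0)) :=
    (((hR N).measurable_gammaHat hg.measurable t hψ.1).sub_const _ |>.const_mul _).const_mul _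
  have hi1 := (hB.integrable_sq_sub 0 N).const_mul (1 / 2)
  have hi2 := (hD.integrable_sq_sub Z N).const_mul (1 / 2 + M)
  rw [← integral_sub]
  · refine (norm_integral_le_of_norm_le ((hi1.add hi2).const_mul (|u| * √(N : ℕ) / Z ^ 2)) ?_).trans ?_
    · filter_upwards [(hR N).ae_weight hg hC (hCN N)] with ω hω
      refine (norm_cexp_mul_I_sub_le _ _).trans ?_
      have hr := abs_gammaHat_div_le hN (fun i => (hω t i).1) hM
      have hg1 : 0 < gammaHat g (fun s => X N s ω) (fun s => α N s ω) t (fun _ => 1) := by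
        have : Nonempty (Fin (N : ℕ)) := ⟨⟨0, hN⟩⟩
        refine mul_pos (by positivity) (Finset.sum_pos (fun i _ => ?_) Finset.univ_nonempty)
        simpa using (hω t i).1
      rw [piHat_sub_eq_div hN (fun i => (hω t i).1)]
      simp only [Pi.add_apply]
      set B := gammaHat g (fun s => X N s ω) (fun s => α N s ω) t ψ
      set G := gammaHat g (fun s => X N s ω) (fun s => α N s ω) t (fun _ => 1)
      -- In this expansion G is a denominator only inside B/G, a weighted average of ψ bounded by M.
      -- No lower bound on G is needed.
      have e2 : u * (√(N : ℕ) * (B / G)) - u / Z * (√(N : ℕ) * (B - 0))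
          = u * √(N : ℕ) / Z ^ 2 * (-(B * (G - Z)) + B / G * (G - Z) ^ 2) := by
        field_simp
        ring
      rw [e2, abs_mul, abs_div, abs_mul, abs_of_pos hs, abs_of_pos (pow_pos hZ 2)]
      refine mul_le_mul_of_nonneg_left ((abs_add_le _ _).trans ?_) (by positivity)
      rw [abs_neg, abs_mul, abs_mul, abs_of_nonneg (sq_nonneg (G - Z)), sub_zero]
      have f1 : |B / G| * (G - Z) ^ 2 ≤ M * (G - Z) ^ 2 :=
        mul_le_mul_of_nonneg_right hr (sq_nonneg _)
      nlinarith [sq_nonneg (|B| - |G - Z|), sq_abs B, sq_abs (G - Z)]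
    · have hi3 := integral_add hi1 hi2
      rw [integral_const_mul]
      simp only [Pi.add_apply] at hi3 ⊢
      rw [hi3, integral_const_mul, integral_const_mul]
      calc _ ≤ |u| * √(N : ℕ) / Z ^ 2 * (1 / 2 * (c1 / ((N : ℕ) : ℝ))
            + (1 / 2 + M) * (c2 / ((N : ℕ) : ℝ))) := by
            gcongr
            · exact hc1 N
            · exact hc2 N
        _ = |u| / Z ^ 2 * (c1 / 2 + (1 / 2 + M) * c2) * (√(N : ℕ) / ((N : ℕ) : ℝ)) := by ring
        _ = _ := by
            have e3 : √((N : ℕ) : ℝ) / ((N : ℕ) : ℝ) = 1 / √((N : ℕ) : ℝ) := by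
              rw [div_eq_div_iff hN0.ne' hs.ne', hss, one_mul]
            rw [e3, mul_one_div]
  · exact Integrable.of_bound (measurable_cexp_mul_I hm1).aestronglyMeasurable 1
      (ae_of_all _ fun ω => (Complex.norm_exp_ofReal_mul_I _).le)
  · exact Integrable.of_bound (measurable_cexp_mul_I hm2).aestronglyMeasurable 1
      (ae_of_all _ fun ω => (Complex.norm_exp_ofReal_mul_I _).le)

end Family

/-- Lévy's continuity theorem for a family indexed by the integers `N ≥ C`, with a Gaussian limit. -/
lemma tendstoInDistribution_gaussianReal_of_charFun {C : ℕ} {Ω : Set.Ici C → Type*}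
    [∀ N, MeasurableSpace (Ω N)] {P : ∀ N, Measure (Ω N)} [∀ N, IsProbabilityMeasure (P N)]
    {T : ∀ N, Ω N → ℝ} (hT : ∀ N, Measurable (T N)) {v : ℝ≥0}
    (h : ∀ u : ℝ, Tendsto (fun N => ∫ ω, Complex.exp (((u * T N ω : ℝ) : ℂ) * Complex.I) ∂P N)
      atTop (nhds (Real.exp (-(u ^ 2 * v / 2)) : ℂ))) :
    TendstoInDistribution T atTop (id : ℝ → ℝ) P (gaussianReal 0 v) := by
  refine ⟨fun N => (hT N).aemeasurable, aemeasurable_id, ?_⟩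
  -- The continuity theorem is applied along the sequence n ↦ C + n, and the limit is carried back
  -- by N ↦ N - C.
  have hseq : Tendsto (fun n : ℕ => (⟨C + n, Set.mem_Ici.2 (Nat.le_add_right C n)⟩ : Set.Ici C))
      atTop atTop :=
    tendsto_atTop.2 fun N => (eventually_ge_atTop (N : ℕ)).mono fun n hn =>
      Subtype.coe_le_coe.1 (hn.trans (Nat.le_add_left n C))
  have hback : Tendsto (fun N : Set.Ici C => (N : ℕ) - C) atTop atTop :=
    tendsto_atTop.2 fun n =>
      (eventually_ge_atTop (⟨C + n, Set.mem_Ici.2 (Nat.le_add_right C n)⟩ : Set.Ici C)).mono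
        fun N hN => by
          have : C + n ≤ (N : ℕ) := hN
          omega
  set ν : Set.Ici C → ProbabilityMeasure ℝ := fun N =>
    ⟨(P N).map (T N), Measure.isProbabilityMeasure_map (hT N).aemeasurable⟩
  have hν : ∀ u, Tendsto (fun N => charFun (ν N : Measure ℝ) u) atTop
      (nhds (charFun ((gaussianReal 0 v).map id) u)) := fun u => by
    rw [Measure.map_id, charFun_gaussianReal]
    convert h u using 2
    · change charFun ((P _).map (T _)) u = _
      rw [charFun_apply_real, integral_map (hT _).aemeasurable (by fun_prop)]
      simp only [Complex.ofReal_mul]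
    · push_cast
      congr 1
      ring
  have hmain := ProbabilityMeasure.tendsto_of_tendsto_charFun (μ₀ := ⟨(gaussianReal 0 v).map id,
    Measure.isProbabilityMeasure_map aemeasurable_id⟩) fun u => (hν u).comp hseq
  refine (hmain.comp hback).congr fun N => congrArg ν (Subtype.ext ?_)
  have : C ≤ (N : ℕ) := N.2
  simp only
  omega

end AlphaSMC

end

/-! ### Identification of the variances and conclusion. -/

theorem theorem3 {S : Type*} [MeasurableSpace S]
    (π₀ : Measure S) [IsProbabilityMeasure π₀]
    (K : ℕ → Kernel S S) [∀ t, IsMarkovKernel (K t)]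
    (g : ℕ → S → ℝ) (hg : ∀ t, Measurable (g t))
    (κ : ℝ) (hκ : ∀ t x, 0 < g t x ∧ g t x ≤ κ)
    (C : ℕ) (hC : 1 ≤ C) :
    ∃ Vγ Vπ : ℕ → (S → ℝ) → ℝ≥0,
      -- the initial variances
      (∀ φ : S → ℝ, AlphaSMC.IsTestFunction φ →
        (Vγ 0 φ : ℝ) = Var[φ; π₀] ∧ (Vπ 0 φ : ℝ) = Var[φ; π₀]) ∧
      -- the recursions
      (∀ (t : ℕ) (φ : S → ℝ), AlphaSMC.IsTestFunction φ →
        (Vγ (t + 1) φ : ℝ)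
            = Vγ t (AlphaSMC.Qop K g t φ)
              + AlphaSMC.muTarget π₀ K g C (t + 1) (fun x => φ x ^ 2)
              - AlphaSMC.normConst π₀ K g (t + 1) ^ 2
                * AlphaSMC.piTarget π₀ K g (t + 1) φ ^ 2 ∧
        (Vπ (t + 1) φ : ℝ)
            = Vπ t (AlphaSMC.Qop K g t
                  (fun x => φ x - AlphaSMC.piTarget π₀ K g (t + 1) φ))
                / AlphaSMC.piTarget π₀ K g t (g t) ^ 2
              + AlphaSMC.muTarget π₀ K g C (t + 1)
                  (fun x => (φ x - AlphaSMC.piTarget π₀ K g (t + 1) φ) ^ 2)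
                / AlphaSMC.normConst π₀ K g (t + 1) ^ 2) ∧
      -- the convergence in law, for any runs of the algorithm with `N ≥ C` particles
      (∀ (Ω : Set.Ici C → Type*) [∀ N, MeasurableSpace (Ω N)]
        (P : ∀ N, Measure (Ω N)) [∀ N, IsProbabilityMeasure (P N)]
        (X : ∀ N : Set.Ici C, ℕ → Ω N → Fin (N : ℕ) → S)
        (α : ∀ N : Set.Ici C, ℕ → Ω N → Fin (N : ℕ) → Fin (N : ℕ) → ℝ),
        (∀ N, AlphaSMC.IsRun (P N) π₀ K g C (X N) (α N)) →
        ∀ (t : ℕ) (φ : S → ℝ), AlphaSMC.IsTestFunction φ →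
          TendstoInDistribution
            (fun (N : Set.Ici C) (ω : Ω N) => √(N : ℕ) *
              (AlphaSMC.gammaHat g (fun s => X N s ω) (fun s => α N s ω) t φ
                - AlphaSMC.gammaTarget π₀ K g t φ))
            atTop (id : ℝ → ℝ) P (gaussianReal 0 (Vγ t φ)) ∧
          TendstoInDistribution
            (fun (N : Set.Ici C) (ω : Ω N) => √(N : ℕ) *
              (AlphaSMC.piHat g (fun s => X N s ω) (fun s => α N s ω) t φ
                - AlphaSMC.piTarget π₀ K g t φ))
            atTop (id : ℝ → ℝ) P (gaussianReal 0 (Vπ t φ))) := by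
  have hgp : AlphaSMC.IsPotential g κ := ⟨hg, fun t x => (hκ t x).1, fun t x => (hκ t x).2⟩
  -- A point of the space is needed to deduce κ ≥ 0 from 0 < g ≤ κ.
  obtain ⟨x₀⟩ : Nonempty S := nonempty_of_isProbabilityMeasure π₀
  have hκ0 : 0 ≤ κ := ((hκ 0 x₀).1.trans_le (hκ 0 x₀).2).le
  have hγ : ∀ (t : ℕ) {φ : S → ℝ}, AlphaSMC.IsTestFunction φ →
      ((AlphaSMC.asympVar π₀ K g C t φ).toNNReal : ℝ) = AlphaSMC.asympVar π₀ K g C t φ :=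
    fun t φ hφ => Real.coe_toNNReal _ (AlphaSMC.asympVar_nonneg hgp hC hφ t)
  have hπ : ∀ (t : ℕ) {φ : S → ℝ}, AlphaSMC.IsTestFunction φ →
      ((AlphaSMC.asympVar π₀ K g C t (fun x => φ x - AlphaSMC.piTarget π₀ K g t φ)
        / AlphaSMC.normConst π₀ K g t ^ 2).toNNReal : ℝ)
      = AlphaSMC.asympVar π₀ K g C t (fun x => φ x - AlphaSMC.piTarget π₀ K g t φ)
        / AlphaSMC.normConst π₀ K g t ^ 2 :=
    fun t φ hφ => Real.coe_toNNReal _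
      (div_nonneg (AlphaSMC.asympVar_nonneg hgp hC (hφ.sub_const _) t) (sq_nonneg _))
  -- `toNNReal` changes nothing on test functions, where the variances are non-negative; V^π is V^γ
  -- of the centred function divided by Z_t².
  refine ⟨fun t φ => (AlphaSMC.asympVar π₀ K g C t φ).toNNReal,
    fun t φ => (AlphaSMC.asympVar π₀ K g C t (fun x => φ x - AlphaSMC.piTarget π₀ K g t φ)
      / AlphaSMC.normConst π₀ K g t ^ 2).toNNReal, fun φ hφ => ⟨?_, ?_⟩,
    fun t φ hφ => ⟨?_, ?_⟩, ?_⟩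
  · rw [hγ 0 hφ, AlphaSMC.asympVar]
  · have hZ : AlphaSMC.normConst π₀ K g 0 = 1 := by
      simp [AlphaSMC.normConst, AlphaSMC.gammaTarget_zero]
    rw [hπ 0 hφ, hZ, AlphaSMC.asympVar, one_pow, div_one]
    exact variance_sub_const hφ.1.aestronglyMeasurable _
  · rw [hγ (t + 1) hφ, hγ t (hφ.qop hgp t), AlphaSMC.asympVar,
      ← AlphaSMC.normConst_mul_piTarget hgp (t + 1) φ]
    ring
  · have hψ := hφ.sub_const (AlphaSMC.piTarget π₀ K g (t + 1) φ)
    have hZ := (AlphaSMC.normConst_pos (π₀ := π₀) (K := K) hgp t).ne'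
    have hZ' := (AlphaSMC.normConst_pos (π₀ := π₀) (K := K) hgp (t + 1)).ne'
    have h0 := AlphaSMC.gammaTarget_sub_piTarget (π₀ := π₀) (K := K) hgp hφ (t + 1)
    -- Q maps the function centred under π_{t+1} to one centred under π_t, so V^π_t of it is simply
    -- V^γ_t / Z_t². Together with Z_{t+1} = Z_t π_t(g_t) this gives the recursion.
    have h1 : AlphaSMC.piTarget π₀ K g t (AlphaSMC.Qop K g t
        fun x => φ x - AlphaSMC.piTarget π₀ K g (t + 1) φ) = 0 := by
      rw [AlphaSMC.piTarget, ← AlphaSMC.gammaTarget_succ, h0, mul_zero]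
    have h2 : AlphaSMC.normConst π₀ K g t * AlphaSMC.piTarget π₀ K g t (g t)
        = AlphaSMC.normConst π₀ K g (t + 1) := by
      rw [AlphaSMC.normConst_mul_piTarget hgp, AlphaSMC.normConst_succ]
    have h3 : AlphaSMC.piTarget π₀ K g t (g t) ≠ 0 := by
      intro h
      rw [h, mul_zero] at h2
      exact hZ' h2.symm
    rw [hπ (t + 1) hφ, hπ t (hψ.qop hgp t), AlphaSMC.asympVar, h0]
    simp only [h1, sub_zero]
    rw [← h2]
    field_simp
    ring
  · intro Ω _ P _ X α hR t φ hφ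
    constructor
    · refine AlphaSMC.tendstoInDistribution_gaussianReal_of_charFun (fun N =>
        (((hR N).measurable_gammaHat hg t hφ.1).sub_const _).const_mul _) fun u => ?_
      rw [hγ t hφ]
      exact AlphaSMC.tendsto_charFun_gammaHat hgp hκ0 hC hR t hφ u
    · refine AlphaSMC.tendstoInDistribution_gaussianReal_of_charFun (fun N =>
        (((hR N).measurable_piHat hg t hφ.1).sub_const _).const_mul _) fun u => ?_
      rw [hπ t hφ]
      exact AlphaSMC.tendsto_charFun_piHat hgp hκ0 hC hR t hφ u
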